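/- Setting. Two datasets $x,x'\in(\mathbb R^d)^n$ are neighboring if they differ in at most one entry. A randomized algorithm (Markov kernel) $M$ from $(\mathbb R^d)^n$ to a measurable space $\mathcal Y$ is $\varepsilon$-differentially private ($\varepsilon$-DP) if $\Pr[M(x)\in Y]\le e^{\varepsilon}\,\Pr[M(x')\in Y]$ for all neighboring $x,x'$ and all measurable $Y\subseteq\mathcal Y$. For probability measures $P,Q$ let $d_{TV}(P,Q)=\sup_A|P(A)-Q(A)|$, over measurable sets $A$, and let $\|\cdot\|_F$ be the Frobenius norm. Below, $d,n\ge 0$ are integers and $\varepsilon>0$ is arbitrary. **Theorem (learning in total variation).** There are absolute constants $\alpha_0\in(0,1]$ and $c>0$ such that the following holds for all $d,n$, all $\varepsilon>0$ and all $0<\alpha\le\alpha_0$. Let $M$ be an $\varepsilon$-DP mechanism which maps $(\mathbb R^d)^n$ to probability measures on $\mathbb R^d$ (not necessarily Gaussian; the space of probability measures carries the $\sigma$-algebra generated by the evaluations $Q\mapsto Q(A)$), and suppose that for every symmetric $\Sigma\in\mathbb R^{d\times d}$ with $\tfrac12 I\preceq\Sigma\preceq\tfrac32 I$, $$\Pr_{X\sim\mathcal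 N(0,\Sigma)^{\otimes n},\,M}\bigl[d_{TV}(\mathcal N(0,\Sigma),M(X))\le\alpha\bigr]\ \ge\ \tfrac23 .$$ Then $n\ge c\,\dfrac{d^2}{\alpha\varepsilon}$. (A fortiori, the same bound holds for mechanisms that are required to learn a larger class of Gaussians on $\mathbb R^d$, or to output a Gaussian.) **Lemma (estimating the covariance in Frobenius norm).** There is an absolute constant $c>0$ such that the following holds for all $d,n$, all $\varepsilon>0$ and all $0<\alpha\le1$. Let $M$ be an $\varepsilon$-DP mechanism which maps $(\mathbb R^d)^n$ to real symmetric positive semidefinite $d\times d$ matrices, and suppose that for every symmetric $\Sigma\in\mathbb R^{d\times d}$ with $\tfrac12 I\preceq\Sigma\preceq\tfrac32 I$, $$\mathbb E_{X\sim\mathcal N(0,\Sigma)^{\otimes n},\,M}\bigl[\|M(X)-\Sigma\|_F^2\bigr]\ \le\ \frac{\alpha^2}{64}.$$ Then $n\ge c\,\dfrac{d^2}{\alpha\varepsilon}$. -/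

import Mathlib

open MeasureTheory ProbabilityTheory

noncomputable section

namespace PrivateCovariance

/-- Two datasets of size `n` are neighboring if they differ in at most one entry. -/
def Neighboring {X : Type*} {n : ℕ} (x x' : Fin n → X) : Prop :=
  {i | x i ≠ x' i}.Subsingleton

/-- `(ε, δ)`-differential privacy of a randomized algorithm `M : X ^ n → Y`, given as a Markov
kernel. Pure `ε`-differential privacy is the case `δ = 0`. -/
def IsDP {X Y : Type*} [MeasurableSpace X] [MeasurableSpace Y] {n : ℕ}
    (M : Kernel (Fin n → X) Y) (ε δ : ℝ) : Prop :=
  ∀ x x' : Fin n → X, Neighboring x x' → ∀ S : Set Y, MeasurableSet S →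
    M x S ≤ ENNReal.ofReal (Real.exp ε) * M x' S + ENNReal.ofReal δ

/-- Total variation distance `sup_A |P(A) - Q(A)|`, the supremum being over measurable sets,
between two probability measures. -/
def tvDist {Ω : Type*} [MeasurableSpace Ω] (P Q : Measure Ω) : ℝ :=
  ⨆ A : {A : Set Ω // MeasurableSet A}, |P.real A.1 - Q.real A.1|

/-- The law of `n` independent samples from the Gaussian `N(0, S)` on `ℝ ^ d`. -/
def gaussianSamples (n : ℕ) {d : ℕ} (S : Matrix (Fin d) (Fin d) ℝ) :
    Measure (Fin n → EuclideanSpace ℝ (Fin d)) :=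
  Measure.pi fun _ => multivariateGaussian 0 S

/-- `(1/2) I ≼ S ≼ (3/2) I` in the Loewner order, for a real matrix `S` (which is then
symmetric). -/
def WellConditioned {d : ℕ} (S : Matrix (Fin d) (Fin d) ℝ) : Prop :=
  (S - (1 / 2 : ℝ) • (1 : Matrix (Fin d) (Fin d) ℝ)).PosSemidef ∧
    ((3 / 2 : ℝ) • (1 : Matrix (Fin d) (Fin d) ℝ) - S).PosSemidef

/-- The mechanism `M`, run on `n` independent samples from `N(0, S)`, outputs with probability
at least `2/3` (over the samples and the randomness of `M`) a probability measure within total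
variation distance `α` of `N(0, S)`, for every `S` with `(1/2) I ≼ S ≼ (3/2) I`. -/
def LearnsGaussian {n d : ℕ}
    (M : Kernel (Fin n → EuclideanSpace ℝ (Fin d))
      (ProbabilityMeasure (EuclideanSpace ℝ (Fin d)))) (α : ℝ) : Prop :=
  ∀ S : Matrix (Fin d) (Fin d) ℝ, WellConditioned S →
    2 / 3 ≤ (M ∘ₘ gaussianSamples n S)
      {Q | tvDist (multivariateGaussian 0 S) (Q : Measure (EuclideanSpace ℝ (Fin d))) ≤ α}

/-- The space of `d × d` real symmetric positive semidefinite matrices. -/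
abbrev PSDMatrix (d : ℕ) : Type := {A : Matrix (Fin d) (Fin d) ℝ // A.PosSemidef}

/-- The Borel `σ`-algebra on positive semidefinite matrices, generated by the entries. -/
instance (d : ℕ) : MeasurableSpace (PSDMatrix d) :=
  MeasurableSpace.comap (fun (A : PSDMatrix d) (i j : Fin d) => A.1 i j) MeasurableSpace.pi

/-- The squared Frobenius norm. -/
def frobeniusSq {d : ℕ} (A : Matrix (Fin d) (Fin d) ℝ) : ℝ := ∑ i, ∑ j, A i j ^ 2

/-- The mechanism `M`, run on `n` independent samples from `N(0, S)`, estimates `S` with expected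
squared Frobenius error at most `r`, for every `S` with `(1/2) I ≼ S ≼ (3/2) I`. -/
def EstimatesCovariance {n d : ℕ}
    (M : Kernel (Fin n → EuclideanSpace ℝ (Fin d)) (PSDMatrix d)) (r : ℝ) : Prop :=
  ∀ S : Matrix (Fin d) (Fin d) ℝ, WellConditioned S →
    ∫⁻ A, ENNReal.ofReal (frobeniusSq (A.1 - S)) ∂(M ∘ₘ gaussianSamples n S)
      ≤ ENNReal.ofReal r

end PrivateCovariance

end

open scoped ENNReal NNReal RealInnerProductSpace

open PrivateCovariance

/-! Packing argument. Take sign patterns on unordered pairs of coordinates from a binary code of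
size `exp (c d ^ 2)`. Perturbing the identity by entries `± ρ / d` gives covariances at Frobenius
distance exactly `ρ` from `I` and pairwise at distance of order `ρ`, with `ρ` of order `α`. An
accurate mechanism has pairwise disjoint success events, each of probability at least `2/3` under
its own Gaussian.

All these Gaussians are close to the same `N(0, I)`: the chi-square divergence is at most `2 ρ ^ 2`,
so each can be coupled to `N(0, I)` with disagreement probability at most `3 ρ / 2`
(`exists_gaussian_coupling`). Coupling `n` samples independently, the datasets differ in `O(n ρ)`
entries outside a small event. Group privacy then gives every success event probability at least a
constant times `exp (-O(ε n ρ))` on standard Gaussian data. Disjointness bounds the code size by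
`O(exp (O(ε n ρ)))` (`IsDP.log_card_le`), hence `d ^ 2 = O(n ρ ε)`.

For learning in total variation, Frobenius separation must also imply total variation separation
(`exists_distinguishing_set`). The witness is the quadratic form of `D = S - T`: its means under the
two Gaussians differ by `‖D‖_F ^ 2`, while its fourth moment under `N(0, I)` is `O(‖D‖_F ^ 4)`. -/

/-! ### Binary codes -/

lemma sum_pow_hammingDist {ι : Type*} [Fintype ι] [DecidableEq ι] (c : ι → Bool) (q : ℝ) :
    ∑ a : ι → Bool, q ^ hammingDist a c = (1 + q) ^ Fintype.card ι := by
  have h (a : ι → Bool) : q ^ hammingDist a c = ∏ i, if a i ≠ c i then q else 1 := by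
    simp [hammingDist, Finset.prod_ite]
  simp_rw [h]
  rw [← Fintype.piFinset_univ, ← Finset.prod_univ_sum (fun _ => Finset.univ)
    (fun i b => if b ≠ c i then q else 1)]
  have (i : ι) : ∑ b : Bool, (if b ≠ c i then q else 1) = 1 + q := by
    cases c i <;> simp [add_comm]
  rw [Finset.prod_congr rfl fun i _ => this i, Finset.prod_const, Finset.card_univ]

/-- A Gilbert–Varshamov bound: there is a binary code of relative distance `2/5` and of positive
rate. -/
lemma exists_separated_code (ι : Type*) [Fintype ι] [DecidableEq ι] :
    ∃ C : Finset (ι → Bool),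
      (∀ a ∈ C, ∀ b ∈ C, a ≠ b → 2 / 5 * (Fintype.card ι : ℝ) ≤ hammingDist a b) ∧
      (Fintype.card ι : ℝ) / 60 ≤ Real.log C.card := by
  classical
  set m : ℝ := (Fintype.card ι : ℝ) with hm
  have hm0 : 0 ≤ m := by positivity
  let p : Finset (ι → Bool) → Prop := fun C =>
    ∀ a ∈ C, ∀ b ∈ C, a ≠ b → 2 / 5 * m ≤ hammingDist a b
  obtain ⟨C, hC, hmax⟩ := Finset.exists_max_image (Finset.univ.filter p) Finset.card
    ⟨∅, by simp [p]⟩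
  have hC' : p C := by simpa using hC
  refine ⟨C, hC', ?_⟩
  -- A maximal separated code is a covering, since an uncovered word could be added to it.
  have hcov (a : ι → Bool) : ∃ c ∈ C, (hammingDist a c : ℝ) ≤ 2 / 5 * m := by
    by_contra! hcon
    have ha : a ∉ C := fun h => by
      have := hcon a h
      simp only [hammingDist_self, Nat.cast_zero] at this
      nlinarith
    have : p (insert a C) := by
      intro x hx y hy hxy
      rcases Finset.mem_insert.1 hx with rfl | hx' <;> rcases Finset.mem_insert.1 hy with rfl | hy'
      · exact absurd rfl hxy
      · exact (hcon y hy').le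
      · rw [hammingDist_comm]; exact (hcon x hx').le
      · exact hC' x hx' y hy' hxy
    have := hmax (insert a C) (by simpa using this)
    rw [Finset.card_insert_of_notMem ha] at this
    omega
  -- Chernoff bound for the Hamming ball: the tilt `exp (-t) = 2/3` is the odds ratio `(2/5) /
  -- (3/5)`, optimal for radius `2/5`.
  set t : ℝ := Real.log (3 / 2)
  have ht : 0 < t := Real.log_pos (by norm_num)
  have hsum : (2 : ℝ) ^ Fintype.card ι ≤
      C.card * (Real.exp (t * (2 / 5 * m)) * (5 / 3) ^ Fintype.card ι) := by
    calc (2 : ℝ) ^ Fintype.card ι = ∑ a : ι → Bool, (1 : ℝ) := by simp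
      _ ≤ ∑ a : ι → Bool, ∑ c ∈ C, Real.exp (t * (2 / 5 * m)) * (2 / 3) ^ hammingDist a c := by
          refine Finset.sum_le_sum fun a _ => ?_
          obtain ⟨c, hc, hac⟩ := hcov a
          refine le_trans ?_ (Finset.single_le_sum
            (f := fun c => Real.exp (t * (2 / 5 * m)) * (2 / 3) ^ hammingDist a c)
            (fun c _ => by positivity) hc)
          have : ((2 : ℝ) / 3) ^ hammingDist a c = Real.exp (-(t * hammingDist a c)) := by
            rw [Real.exp_neg, mul_comm, Real.exp_nat_mul, Real.exp_log (by norm_num), ← inv_pow]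
            norm_num
          simp only [this, ← Real.exp_add]
          refine Real.one_le_exp ?_
          nlinarith
      _ = _ := by
          rw [Finset.sum_comm]
          simp_rw [← Finset.mul_sum, sum_pow_hammingDist]
          rw [Finset.sum_const, nsmul_eq_mul]
          norm_num
          ring
  have hCpos : (0 : ℝ) < C.card := by
    by_contra! h
    have : (C.card : ℝ) = 0 := le_antisymm h (by positivity)
    rw [this, zero_mul] at hsum
    exact absurd hsum (not_le.2 (by positivity))
  have hlog := Real.log_le_log (by positivity) hsum
  rw [Real.log_mul hCpos.ne' (by positivity), Real.log_mul (by positivity) (by positivity),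
    Real.log_exp, Real.log_pow, Real.log_pow] at hlog
  have hnum : (1 : ℝ) / 12 ≤ 5 * Real.log 2 - 2 * t - 5 * Real.log (5 / 3) := by
    have h0 : 5 * Real.log 2 - 2 * t - 5 * Real.log (5 / 3) = Real.log (31104 / 28125) := by
      have h1 := Real.log_pow (2 : ℝ) 5
      have h2 := Real.log_pow (3 / 2 : ℝ) 2
      have h3 := Real.log_pow (5 / 3 : ℝ) 5
      push_cast at h1 h2 h3
      rw [← h1, ← h2, ← h3, ← Real.log_div (by positivity) (by positivity),
        ← Real.log_div (by positivity) (by positivity)]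
      norm_num
    rw [h0]
    exact le_trans (by norm_num) (Real.one_sub_inv_le_log_of_pos (by norm_num))
  rw [← hm] at hlog
  nlinarith [mul_le_mul_of_nonneg_left hnum hm0]

/-! ### Maximal coupling -/

/-- Two probability measures, one of which has a density `l` with respect to the other, have a
coupling which charges the complement of the diagonal by at most `∫ |l - 1|`. -/
lemma exists_coupling_withDensity {E : Type*} [MeasurableSpace E] [MeasurableEq E]
    (Q : Measure E) [IsProbabilityMeasure Q] (l : E → ℝ≥0∞) (hl : Measurable l)
    [IsProbabilityMeasure (Q.withDensity l)] :
    ∃ γ : Measure (E × E), IsProbabilityMeasure γ ∧ γ.map Prod.fst = Q.withDensity l ∧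
      γ.map Prod.snd = Q ∧ γ {z | z.1 ≠ z.2} ≤ ∫⁻ x, (1 - l x) ∂Q := by
  set R : Measure E := Q.withDensity fun x => min (l x) 1 with hR
  set P' : Measure E := Q.withDensity fun x => l x - 1 with hP'
  set Q' : Measure E := Q.withDensity fun x => 1 - l x with hQ'
  have hRP : R + P' = Q.withDensity l := by
    rw [hR, hP', ← withDensity_add_left (by fun_prop)]
    congr 1; ext x
    simp only [Pi.add_apply]
    rcases le_total (l x) 1 with h | h
    · simp [h, tsub_eq_zero_of_le h]
    · simp [h, add_tsub_cancel_of_le h]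
  have hRQ : R + Q' = Q := by
    conv_rhs => rw [← withDensity_one (μ := Q)]
    rw [hR, hQ', ← withDensity_add_left (by fun_prop)]
    congr 1; ext x
    simp only [Pi.add_apply, Pi.one_apply]
    rcases le_total (l x) 1 with h | h
    · simp [h, add_tsub_cancel_of_le h]
    · simp [h, tsub_eq_zero_of_le h]
  have hP1 : R Set.univ + P' Set.univ = 1 := by
    rw [← Measure.add_apply, hRP, measure_univ]
  have hQ1 : R Set.univ + Q' Set.univ = 1 := by
    rw [← Measure.add_apply, hRQ, measure_univ]
  have hRfin : R Set.univ ≠ ∞ := fun h => by simp [h] at hQ1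
  set p : ℝ≥0∞ := Q' Set.univ with hp
  have hPp : P' Set.univ = p := by
    rw [hp]; exact (ENNReal.add_right_inj hRfin).1 (hP1.trans hQ1.symm)
  have hpfin : p ≠ ∞ := fun h => by simp [h] at hQ1
  have : IsFiniteMeasure Q' := ⟨by rw [← hp]; exact hpfin.lt_top⟩
  have : IsFiniteMeasure P' := ⟨by rw [hPp]; exact hpfin.lt_top⟩
  -- If `p = 0` then `p⁻¹ = ∞`, but the excess measures vanish, so no separate treatment of equal
  -- measures is needed below.
  have hcancel (ν : Measure E) (hν : ν Set.univ = p) : p⁻¹ • p • ν = ν := by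
    rcases eq_or_ne p 0 with h0 | h0
    · rw [h0, Measure.measure_univ_eq_zero] at hν
      simp [hν]
    · rw [smul_smul, ENNReal.inv_mul_cancel h0 hpfin, one_smul]
  have hd : Measurable fun x : E => (x, x) := by fun_prop
  -- The common part sits on the diagonal; the two excesses, both of mass `p`, are joined by a
  -- normalised product.
  set γ : Measure (E × E) := R.map (fun x => (x, x)) + p⁻¹ • P'.prod Q' with hγ
  have h1 : γ.map Prod.fst = Q.withDensity l := by
    rw [hγ, Measure.map_add _ _ measurable_fst, Measure.map_map measurable_fst hd,
      Measure.map_smul, Measure.map_fst_prod, ← hp, hcancel _ hPp, ← hRP]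
    congr 1
    exact Measure.map_id
  have h2 : γ.map Prod.snd = Q := by
    rw [hγ, Measure.map_add _ _ measurable_snd, Measure.map_map measurable_snd hd,
      Measure.map_smul, Measure.map_snd_prod, hPp, hcancel _ hp.symm]
    conv_rhs => rw [← hRQ]
    congr 1
    exact Measure.map_id
  refine ⟨γ, ⟨?_⟩, h1, h2, ?_⟩
  · rw [← Set.preimage_univ (f := Prod.snd), ← Measure.map_apply measurable_snd .univ, h2,
      measure_univ]
  · have hD : MeasurableSet {z : E × E | z.1 ≠ z.2} :=
      (measurableSet_eq_fun measurable_fst measurable_snd).compl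
    have h0 : (R.map fun x => (x, x)) {z : E × E | z.1 ≠ z.2} = 0 := by
      rw [Measure.map_apply hd hD]; simp
    calc γ {z | z.1 ≠ z.2} = p⁻¹ * (P'.prod Q') {z | z.1 ≠ z.2} := by
          rw [hγ, Measure.add_apply, h0, zero_add, Measure.smul_apply, smul_eq_mul]
      _ ≤ p⁻¹ * (P'.prod Q') Set.univ := by gcongr; exact Set.subset_univ _
      _ = p⁻¹ * p * p := by
          rw [← Set.univ_prod_univ, Measure.prod_prod, hPp, ← hp, mul_assoc]
      _ ≤ 1 * p := by gcongr; exact ENNReal.inv_mul_le_one p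
      _ = ∫⁻ x, (1 - l x) ∂Q := by
          rw [one_mul, hp, hQ', withDensity_apply _ .univ, Measure.restrict_univ]

/-! ### Group privacy and the packing bound -/

section Privacy

variable {X Y : Type*} [MeasurableSpace X] [MeasurableSpace Y] {n : ℕ}
  {M : Kernel (Fin n → X) Y} {ε : ℝ}

/-- The entries of `x` are replaced by those of `x'` one at a time, each replacement costing a
factor `exp ε`. -/
lemma PrivateCovariance.IsDP.group (hM : IsDP M ε 0) {S : Set Y} (hS : MeasurableSet S)
    (x x' : Fin n → X) [DecidableEq X] :
    M x S ≤ ENNReal.ofReal (Real.exp (ε * hammingDist x x')) * M x' S := by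
  have key (T : Finset (Fin n)) :
      M x S ≤ ENNReal.ofReal (Real.exp (ε * T.card)) * M (T.piecewise x' x) S := by
    induction T using Finset.induction_on with
    | empty => simp
    | insert i T hi ih =>
      have hn : Neighboring (T.piecewise x' x) ((insert i T).piecewise x' x) := by
        rw [Finset.piecewise_insert]
        intro j hj k hk
        have (j : Fin n)
            (hj : T.piecewise x' x j ≠ Function.update (T.piecewise x' x) i (x' i) j) : j = i := by
          by_contra h
          simp [h] at hj
        rw [this j hj, this k hk]
      refine ih.trans ?_
      have := hM _ _ hn S hS
      rw [ENNReal.ofReal_zero, add_zero] at this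
      calc _ ≤ ENNReal.ofReal (Real.exp (ε * T.card)) *
            (ENNReal.ofReal (Real.exp ε) * M ((insert i T).piecewise x' x) S) := by gcongr
        _ = _ := by
          rw [← mul_assoc, ← ENNReal.ofReal_mul (by positivity), ← Real.exp_add,
            Finset.card_insert_of_notMem hi]
          push_cast
          ring_nf
  have := key (Finset.univ.filter fun i => x i ≠ x' i)
  have hpw : (Finset.univ.filter fun i => x i ≠ x' i).piecewise x' x = x' := by
    ext i
    by_cases h : x i = x' i <;> simp [Finset.piecewise, h]
  rwa [hpw] at this

/-- A differentially private mechanism, run on `n` samples from `P` and on `n` samples from `Q`,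
behaves similarly if `P` and `Q` are close in total variation. -/
lemma PrivateCovariance.IsDP.comp_pi_le [MeasurableEq X] (hM : IsDP M ε 0) (hε : 0 < ε)
    {S : Set Y} (hS : MeasurableSet S) {P Q : Measure X} (γ : Measure (X × X))
    [IsProbabilityMeasure γ] (hP : γ.map Prod.fst = P) (hQ : γ.map Prod.snd = Q) [IsMarkovKernel M]
    {p : ℝ} (hp : 0 < p) (hγ : γ {z | z.1 ≠ z.2} ≤ ENNReal.ofReal p) :
    (M ∘ₘ Measure.pi fun _ : Fin n => P) S ≤
      ENNReal.ofReal (Real.exp (ε * (24 * n * p))) * (M ∘ₘ Measure.pi fun _ : Fin n => Q) S +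
        ENNReal.ofReal (1 / 24) := by
  classical
  -- Markov's inequality below needs a positive threshold `24 n p`; for `n = 0` the two product
  -- measures coincide.
  rcases Nat.eq_zero_or_pos n with rfl | hn
  · have : (fun _ : Fin 0 => P) = fun _ => Q := funext fun i => i.elim0
    have h2 : (Measure.pi fun _ : Fin 0 => P) = Measure.pi fun _ : Fin 0 => Q := by
      congr
    simp [h2]
  have : IsProbabilityMeasure P := hP ▸ Measure.isProbabilityMeasure_map (by fun_prop)
  have : IsProbabilityMeasure Q := hQ ▸ Measure.isProbabilityMeasure_map (by fun_prop)
  set G : Measure (Fin n → X × X) := Measure.pi fun _ => γ with hG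
  have hGP : (Measure.pi fun _ : Fin n => P) = G.map fun z i => (z i).1 := by
    rw [hG, Measure.pi_map_pi (fun _ => by fun_prop), hP]
  have hGQ : (Measure.pi fun _ : Fin n => Q) = G.map fun z i => (z i).2 := by
    rw [hG, Measure.pi_map_pi (fun _ => by fun_prop), hQ]
  have hMS : Measurable fun x => M x S := M.measurable_coe hS
  have hDm : MeasurableSet {z : X × X | z.1 ≠ z.2} :=
    (measurableSet_eq_fun measurable_fst measurable_snd).compl
  have hPi : (M ∘ₘ Measure.pi fun _ : Fin n => P) S = ∫⁻ z, M (fun i => (z i).1) S ∂G := by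
    rw [Measure.bind_apply hS M.aemeasurable, hGP, lintegral_map hMS (by fun_prop)]
  have hQi : (M ∘ₘ Measure.pi fun _ : Fin n => Q) S = ∫⁻ z, M (fun i => (z i).2) S ∂G := by
    rw [Measure.bind_apply hS M.aemeasurable, hGQ, lintegral_map hMS (by fun_prop)]
  let D : (Fin n → X × X) → ℝ≥0∞ := fun z =>
    ∑ i, Set.indicator {w : X × X | w.1 ≠ w.2} (fun _ => 1) (z i)
  have hD : Measurable D := by
    refine Finset.measurable_sum _ fun i _ => ?_
    exact (measurable_const.indicator hDm).comp (measurable_pi_apply i)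
  have hDh (z : Fin n → X × X) : D z = (hammingDist (fun i => (z i).1) (fun i => (z i).2) : ℕ) := by
    simp [D, hammingDist, Set.indicator_apply, Finset.sum_ite]
  have hDint : ∫⁻ z, D z ∂G ≤ n * ENNReal.ofReal p := by
    have hsum : ∫⁻ z, D z ∂G =
        ∑ i, ∫⁻ z, Set.indicator {w : X × X | w.1 ≠ w.2} (fun _ => 1) (z i) ∂G :=
      lintegral_finsetSum _ fun i _ =>
        (measurable_const.indicator hDm).comp (measurable_pi_apply i)
    rw [hsum]
    refine (Finset.sum_le_sum (g := fun _ => ENNReal.ofReal p) fun i _ => ?_).trans (by simp)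
    have := (measurePreserving_eval (fun _ : Fin n => γ) i).lintegral_comp
      (measurable_const (a := (1 : ℝ≥0∞)) |>.indicator hDm)
    rw [hG]
    refine (le_of_eq this).trans ?_
    rwa [lintegral_indicator_const hDm, one_mul]
  -- The expected number of disagreements is at most `n p`, so exceeding `24` times that has
  -- probability at most `1/24`. This leaves `2/3 - 1/24 = 5/8` in the packing bound.
  set k : ℝ := 24 * n * p with hk
  have hkpos : 0 < k := by positivity
  have hmark : G {z | ENNReal.ofReal k ≤ D z} ≤ ENNReal.ofReal (1 / 24) := by
    refine (meas_ge_le_lintegral_div hD.aemeasurable (by simpa using hkpos) (by simp)).trans ?_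
    refine ENNReal.div_le_of_le_mul (hDint.trans (le_of_eq ?_))
    rw [← ENNReal.ofReal_mul (by norm_num), ← ENNReal.ofReal_natCast,
      ← ENNReal.ofReal_mul (by positivity)]
    congr 1
    rw [hk]; ring
  have hB : MeasurableSet {z | ENNReal.ofReal k ≤ D z} := measurableSet_le measurable_const hD
  have hMS' : Measurable fun z : Fin n → X × X => M (fun i => (z i).2) S :=
    hMS.comp (by fun_prop)
  rw [hPi, hQi, ← lintegral_const_mul _ hMS']
  calc ∫⁻ z, M (fun i => (z i).1) S ∂G
      ≤ ∫⁻ z, (ENNReal.ofReal (Real.exp (ε * k)) * M (fun i => (z i).2) S +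
          Set.indicator {z | ENNReal.ofReal k ≤ D z} (fun _ => 1) z) ∂G := by
        refine lintegral_mono fun z => ?_
        by_cases hz : ENNReal.ofReal k ≤ D z
        · rw [Set.indicator_of_mem (by exact hz)]
          exact prob_le_one.trans le_add_self
        · refine (hM.group hS _ fun i => (z i).2).trans (le_trans ?_ le_self_add)
          gcongr
          rw [hDh, not_le, ← ENNReal.ofReal_natCast, ENNReal.ofReal_lt_ofReal_iff hkpos] at hz
          exact hz.le
    _ ≤ _ := by
        rw [lintegral_add_right _ (measurable_const.indicator hB),
          lintegral_indicator_const hB, one_mul]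
        gcongr

/-- The packing lower bound on the sample size of a differentially private mechanism. -/
lemma PrivateCovariance.IsDP.log_card_le [MeasurableEq X] (hM : IsDP M ε 0) (hε : 0 < ε)
    [IsMarkovKernel M] {κ : Type*} (C : Finset κ) (P : κ → Measure X) (Q : Measure X)
    [IsProbabilityMeasure Q] (S : κ → Set Y) (hS : ∀ a ∈ C, MeasurableSet (S a))
    (hdisj : (C : Set κ).PairwiseDisjoint S)
    {p : ℝ} (hp : 0 < p) (hc : ∀ a ∈ C, ∃ γ : Measure (X × X), IsProbabilityMeasure γ ∧
      γ.map Prod.fst = P a ∧ γ.map Prod.snd = Q ∧ γ {z | z.1 ≠ z.2} ≤ ENNReal.ofReal p)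
    (hsucc : ∀ a ∈ C, 2 / 3 ≤ (M ∘ₘ Measure.pi fun _ : Fin n => P a) (S a))
    (hC : 0 < Real.log C.card) :
    Real.log C.card ≤ 96 * n * p * ε := by
  set ν : Measure Y := M ∘ₘ Measure.pi fun _ : Fin n => Q with hν
  set e := Real.exp (ε * (24 * n * p)) with he
  have hsum : ∑ a ∈ C, ν (S a) ≤ 1 := by
    rw [← measure_biUnion_finset hdisj hS]; exact prob_le_one
  have hone (a : κ) (ha : a ∈ C) : (5 / 8 : ℝ) ≤ e * ν.real (S a) := by
    obtain ⟨γ, hγ, h1, h2, h3⟩ := hc a ha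
    have := (hsucc a ha).trans (hM.comp_pi_le hε (hS a ha) γ h1 h2 hp h3)
    rw [← hν, ← he] at this
    have h4 := ENNReal.toReal_mono (by finiteness) this
    rw [ENNReal.toReal_add (by finiteness) (by finiteness), ENNReal.toReal_mul,
      ENNReal.toReal_ofReal (by positivity), ENNReal.toReal_ofReal (by positivity),
      ENNReal.toReal_div] at h4
    simp only [ENNReal.toReal_ofNat] at h4
    change _ ≤ e * ν.real (S a) + _ at h4
    linarith
  have hsum' : ∑ a ∈ C, ν.real (S a) ≤ 1 := by
    have := ENNReal.toReal_mono (by finiteness) hsum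
    rwa [ENNReal.toReal_sum (fun _ _ => by finiteness), ENNReal.toReal_one] at this
  have hN : (C.card : ℝ) * (5 / 8) ≤ e := by
    calc (C.card : ℝ) * (5 / 8) = ∑ a ∈ C, (5 / 8 : ℝ) := by simp
      _ ≤ ∑ a ∈ C, e * ν.real (S a) := Finset.sum_le_sum hone
      _ = e * ∑ a ∈ C, ν.real (S a) := by rw [Finset.mul_sum]
      _ ≤ e * 1 := by gcongr
      _ = e := mul_one e
  have hc2 : (2 : ℝ) ≤ C.card := by
    have : 1 < C.card := by
      by_contra! h
      interval_cases h' : C.card <;> simp at hC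
    exact_mod_cast this
  -- The loss of the factor `5/8` is absorbed by a fourth power, as `8 (5/8) ^ 4 > 1`; the `96` is
  -- `4 · 24`.
  have h4 : (C.card : ℝ) ≤ ((C.card : ℝ) * (5 / 8)) ^ 4 := by
    have : (8 : ℝ) ≤ (C.card : ℝ) ^ 3 := by
      calc (8 : ℝ) = 2 ^ 3 := by norm_num
        _ ≤ _ := by gcongr
    nlinarith
  have := Real.log_le_log (by linarith) (h4.trans (pow_le_pow_left₀ (by positivity) hN 4))
  rw [Real.log_pow, he, Real.log_exp] at this
  push_cast at this
  linarith

end Privacy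

/-! ### One-dimensional Gaussian densities -/

lemma gaussianReal_exp_sq {s : ℝ} (hs : s < 1 / 2) :
    Integrable (fun z : ℝ => Real.exp (s * z ^ 2)) (gaussianReal 0 1) ∧
      ∫ z, Real.exp (s * z ^ 2) ∂gaussianReal 0 1 = (√(1 - 2 * s))⁻¹ := by
  have h (z : ℝ) : gaussianPDFReal 0 1 z * Real.exp (s * z ^ 2) =
      (√(2 * Real.pi))⁻¹ * Real.exp (-(1 / 2 - s) * z ^ 2) := by
    simp only [gaussianPDFReal, NNReal.coe_one, mul_one, sub_zero]
    rw [mul_assoc, ← Real.exp_add]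
    ring_nf
  constructor
  · rw [gaussianReal_of_var_ne_zero _ one_ne_zero, integrable_withDensity_iff_integrable_smul'
      (measurable_gaussianPDF 0 1) (by simp [gaussianPDF_lt_top])]
    simp only [toReal_gaussianPDF, smul_eq_mul, h]
    exact (integrable_exp_neg_mul_sq (by linarith)).const_mul _
  · rw [integral_gaussianReal_eq_integral_smul one_ne_zero]
    simp only [smul_eq_mul, h]
    rw [integral_const_mul, integral_gaussian, ← Real.sqrt_inv, ← Real.sqrt_inv,
      ← Real.sqrt_mul (by positivity)]
    congr 1
    have := Real.pi_pos
    have h1 : 1 / 2 - s ≠ 0 := by linarith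
    have h2 : 1 - 2 * s ≠ 0 := by linarith
    field_simp

/-- The density of `N(0, v)` with respect to `N(0, 1)`. -/
noncomputable def gaussianRatio (v : ℝ≥0) (z : ℝ) : ℝ :=
  (√v)⁻¹ * Real.exp ((1 - (v : ℝ)⁻¹) / 2 * z ^ 2)

lemma gaussianRatio_nonneg (v : ℝ≥0) (z : ℝ) : 0 ≤ gaussianRatio v z := by
  unfold gaussianRatio; positivity

lemma measurable_gaussianRatio (v : ℝ≥0) : Measurable (gaussianRatio v) := by
  unfold gaussianRatio; fun_prop

lemma gaussianReal_eq_withDensity_gaussianRatio {v : ℝ≥0} (hv : v ≠ 0) :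
    gaussianReal 0 v =
      (gaussianReal 0 1).withDensity fun z => ENNReal.ofReal (gaussianRatio v z) := by
  rw [gaussianReal_of_var_ne_zero _ hv, gaussianReal_of_var_ne_zero _ one_ne_zero,
    ← withDensity_mul _ (measurable_gaussianPDF 0 1) (measurable_gaussianRatio v).ennreal_ofReal]
  congr 1
  ext z
  have hv' : (0 : ℝ) < v := by positivity
  rw [Pi.mul_apply, gaussianPDF, gaussianPDF, ← ENNReal.ofReal_mul (gaussianPDFReal_nonneg _ _ _)]
  congr 1
  simp only [gaussianPDFReal, gaussianRatio, NNReal.coe_one, mul_one, sub_zero]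
  rw [Real.sqrt_mul (by positivity), mul_inv, mul_mul_mul_comm, ← Real.exp_add]
  congr 2
  field_simp
  ring

lemma integrable_gaussianRatio {v : ℝ≥0} (hv : v ≠ 0) :
    Integrable (gaussianRatio v) (gaussianReal 0 1) := by
  have : (0 : ℝ) < (v : ℝ)⁻¹ := by positivity
  exact (gaussianReal_exp_sq (by linarith)).1.const_mul _

/-- The squared density is a Gaussian exponential with coefficient `1 - 1 / v`, integrable because
`v < 2`; the value simplifies by `v (2 - v) = 1 - (v - 1) ^ 2`. -/
lemma integral_gaussianRatio_sq {v : ℝ≥0} (hv : v ≠ 0) (hv2 : (v : ℝ) < 2) :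
    Integrable (fun z => gaussianRatio v z ^ 2) (gaussianReal 0 1) ∧
      ∫ z, gaussianRatio v z ^ 2 ∂gaussianReal 0 1 = (√(1 - ((v : ℝ) - 1) ^ 2))⁻¹ := by
  have hv' : (0 : ℝ) < v := by positivity
  have h (z : ℝ) : gaussianRatio v z ^ 2 = (v : ℝ)⁻¹ * Real.exp ((1 - (v : ℝ)⁻¹) * z ^ 2) := by
    rw [gaussianRatio, mul_pow, inv_pow, Real.sq_sqrt hv'.le, ← Real.exp_nat_mul]
    congr 2
    push_cast
    ring
  have hs : 1 - (v : ℝ)⁻¹ < 1 / 2 := by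
    have : (2 : ℝ)⁻¹ < (v : ℝ)⁻¹ := by gcongr
    linarith
  simp only [h]
  refine ⟨(gaussianReal_exp_sq hs).1.const_mul _, ?_⟩
  rw [integral_const_mul, (gaussianReal_exp_sq hs).2, ← mul_inv]
  congr 1
  have : (v : ℝ) = √((v : ℝ) ^ 2) := (Real.sqrt_sq hv'.le).symm
  nth_rw 1 [this]
  rw [← Real.sqrt_mul (by positivity)]
  congr 1
  field_simp
  ring

lemma inv_sqrt_one_sub_sq_le {x : ℝ} (hx : x ^ 2 ≤ 1 / 2) :
    (√(1 - x ^ 2))⁻¹ ≤ Real.exp (x ^ 2) := by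
  have h1 : 1 ≤ Real.exp (x ^ 2) ^ 2 * (1 - x ^ 2) := by
    rw [← Real.exp_nat_mul]
    have := Real.add_one_le_exp (((2 : ℕ) : ℝ) * x ^ 2)
    push_cast at this ⊢
    nlinarith [sq_nonneg x]
  have h2 : 0 < √(1 - x ^ 2) := Real.sqrt_pos.2 (by linarith)
  rw [inv_le_iff_one_le_mul₀ h2]
  conv_rhs => rw [← Real.sqrt_sq (Real.exp_pos (x ^ 2)).le, ← Real.sqrt_mul (by positivity)]
  exact Real.one_le_sqrt.2 h1

lemma inv_sqrt_one_sub_le {s : ℝ} (hs : |s| ≤ 1 / 4) :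
    (√(1 - 2 * s))⁻¹ ≤ Real.exp (s + 2 * s ^ 2) := by
  obtain ⟨hl, hu⟩ := abs_le.1 hs
  have h1 : 1 ≤ Real.exp (s + 2 * s ^ 2) ^ 2 * (1 - 2 * s) := by
    rw [← Real.exp_nat_mul]
    push_cast
    have he : 2 * (s + 2 * s ^ 2) = (2 * s) + (2 * s) ^ 2 := by ring
    rw [he]
    rcases le_total s 0 with h | h
    · have := Real.add_one_le_exp ((2 * s) + (2 * s) ^ 2)
      have h3 : (2 * s) ^ 3 ≤ 0 := by nlinarith [sq_nonneg s]
      nlinarith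
    -- With `y = 2 s`, the linear bound on `exp` only gives `1 - y ^ 3`, too small for `y > 0`; the
    -- quadratic term repairs this.
    · have := Real.quadratic_le_exp_of_nonneg (x := (2 * s) + (2 * s) ^ 2) (by positivity)
      set y := 2 * s with hy
      have hy2 : y ≤ 1 / 2 := by linarith
      have hy0 : 0 ≤ y := by linarith
      have h3 : 1 ≤ (1 + (y + y ^ 2) + (y + y ^ 2) ^ 2 / 2) * (1 - y) := by
        have h4 : 0 ≤ 1 - y - y ^ 2 - y ^ 3 := by nlinarith [mul_nonneg hy0 hy0]
        nlinarith [mul_nonneg (sq_nonneg y) h4]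
      nlinarith
  have h2 : 0 < √(1 - 2 * s) := Real.sqrt_pos.2 (by linarith)
  rw [inv_le_iff_one_le_mul₀ h2]
  conv_rhs => rw [← Real.sqrt_sq (Real.exp_pos (s + 2 * s ^ 2)).le,
    ← Real.sqrt_mul (by positivity)]
  exact Real.one_le_sqrt.2 h1

/-- A product of measures with densities has the product density. -/
lemma MeasureTheory.Measure.pi_withDensity {ι : Type*} [Fintype ι] {E : ι → Type*}
    [∀ i, MeasurableSpace (E i)] (μ : ∀ i, Measure (E i)) [∀ i, SigmaFinite (μ i)]
    (l : ∀ i, E i → ℝ) (hl : ∀ i, Integrable (l i) (μ i)) (h0 : ∀ i x, 0 ≤ l i x) :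
    (Measure.pi fun i => (μ i).withDensity fun x => ENNReal.ofReal (l i x)) =
      (Measure.pi μ).withDensity fun x => ENNReal.ofReal (∏ i, l i (x i)) := by
  have (i : ι) : IsFiniteMeasure ((μ i).withDensity fun x => ENNReal.ofReal (l i x)) :=
    isFiniteMeasure_withDensity_ofReal (hl i).2
  refine Measure.pi_eq fun s hs => ?_
  have hls (i : ι) : Integrable ((s i).indicator (l i)) (μ i) := (hl i).indicator (hs i)
  have hls0 (i : ι) (x : E i) : 0 ≤ (s i).indicator (l i) x :=
    Set.indicator_nonneg (fun x _ => h0 i x) x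
  have h1 (i : ι) : (μ i).withDensity (fun x => ENNReal.ofReal (l i x)) (s i) =
      ENNReal.ofReal (∫ x, (s i).indicator (l i) x ∂μ i) := by
    rw [withDensity_apply _ (hs i), ofReal_integral_eq_lintegral_ofReal (hls i)
      (.of_forall (hls0 i)), ← lintegral_indicator (hs i)]
    congr 1; ext x
    by_cases hx : x ∈ s i <;> simp [hx]
  have hbox : MeasurableSet (Set.univ.pi s) := .univ_pi hs
  have h2 (x : ∀ i, E i) :
      (Set.univ.pi s).indicator (fun x => ENNReal.ofReal (∏ i, l i (x i))) x =
        ENNReal.ofReal (∏ i, (s i).indicator (l i) (x i)) := by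
    by_cases hx : x ∈ Set.univ.pi s
    · rw [Set.indicator_of_mem hx]
      congr 1
      refine Finset.prod_congr rfl fun i _ => ?_
      rw [Set.indicator_of_mem (hx i (Set.mem_univ i))]
    · rw [Set.indicator_of_notMem hx]
      simp only [Set.mem_pi, Set.mem_univ, true_imp_iff, not_forall] at hx
      obtain ⟨i, hi⟩ := hx
      rw [Finset.prod_eq_zero (Finset.mem_univ i) (Set.indicator_of_notMem hi _),
        ENNReal.ofReal_zero]
  rw [withDensity_apply _ hbox, ← lintegral_indicator hbox]
  simp only [h1, h2]
  rw [← ofReal_integral_eq_lintegral_ofReal (Integrable.fintype_prod_dep hls)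
    (.of_forall fun x => Finset.prod_nonneg fun i _ => hls0 i _),
    integral_fintype_prod_eq_prod (fun i => (s i).indicator (l i)),
    ENNReal.ofReal_prod_of_nonneg fun i _ => integral_nonneg (hls0 i)]

/-! ### Gaussian measures in an eigenbasis -/

section Basis

variable {ι κ : Type*} [Fintype ι] [Fintype κ]

lemma measurePreserving_repr_stdGaussian (b : OrthonormalBasis ι ℝ (EuclideanSpace ℝ κ)) :
    MeasurePreserving (fun x i => b.repr x i) (stdGaussian (EuclideanSpace ℝ κ))
      (Measure.pi fun _ => gaussianReal 0 1) := by
  classical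
  have hm : Measurable fun (x : EuclideanSpace ℝ κ) i => b.repr x i := by fun_prop
  refine ⟨hm, ?_⟩
  rw [stdGaussian_eq_map_pi_orthonormalBasis b, Measure.map_map hm (by fun_prop)]
  convert Measure.map_id
  ext y i
  simp [b.repr_apply_apply, inner_sum, inner_smul_right, b.inner_eq_ite]

variable [DecidableEq κ]

/-- The basis is a parameter so that the eigenbasis of `S - 1` can also serve for `S` and for shifts
by multiples of the identity. -/
lemma dotProduct_mulVec_eq_sum (b : OrthonormalBasis ι ℝ (EuclideanSpace ℝ κ))
    (A : Matrix κ κ ℝ) (e : ι → ℝ) (hA : ∀ i, A.mulVec (b i) = e i • (b i).ofLp)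
    (x : EuclideanSpace ℝ κ) :
    x ⬝ᵥ A.mulVec x = ∑ i, e i * b.repr x i ^ 2 := by
  have hA' (i : ι) : Matrix.toEuclideanLin A (b i) = e i • b i := by
    ext j
    simp [Matrix.toLpLin_apply, hA]
  have h1 : x ⬝ᵥ A.mulVec x = ⟪x, Matrix.toEuclideanLin A x⟫ := by
    simp [EuclideanSpace.inner_eq_star_dotProduct, Matrix.toLpLin_apply, dotProduct_comm]
  rw [h1]
  conv_lhs => rw [← b.sum_repr x]
  nth_rw 1 [b.sum_repr x]
  rw [map_sum, inner_sum]
  refine Finset.sum_congr rfl fun i _ => ?_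
  rw [map_smul, hA', inner_smul_right, inner_smul_right, b.repr_apply_apply, real_inner_comm]
  ring

/-- Both characteristic functions are the exponential of the same diagonalised quadratic form. -/
lemma multivariateGaussian_eq_map_pi (b : OrthonormalBasis ι ℝ (EuclideanSpace ℝ κ))
    {A : Matrix κ κ ℝ} (hA : A.PosSemidef) (v : ι → ℝ≥0)
    (hv : ∀ i, A.mulVec (b i) = (v i : ℝ) • (b i).ofLp) :
    multivariateGaussian 0 A =
      (Measure.pi fun i => gaussianReal 0 (v i)).map fun y => ∑ i, y i • b i := by
  apply Measure.ext_of_charFun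
  ext t
  rw [charFun_multivariateGaussian hA, charFun_apply,
    integral_map (Measurable.aemeasurable (by fun_prop))
      (Measurable.aestronglyMeasurable (by fun_prop))]
  simp_rw [sum_inner, Complex.ofReal_sum, Finset.sum_mul, Complex.exp_sum]
  rw [integral_fintype_prod_eq_prod
    (f := fun i (x : ℝ) => Complex.exp (⟪x • b i, t⟫ * Complex.I))]
  simp_rw [real_inner_smul_left, mul_comm _ (⟪_, _⟫), Complex.ofReal_mul, ← charFun_apply_real,
    charFun_gaussianReal, ← Complex.exp_sum]
  have := dotProduct_mulVec_eq_sum b A _ hv t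
  congr 1
  rw [this]
  simp [b.repr_apply_apply, Finset.sum_div]

/-- The density of a Gaussian measure with respect to the standard Gaussian measure, in a basis of
eigenvectors of the covariance matrix. -/
lemma multivariateGaussian_eq_withDensity (b : OrthonormalBasis ι ℝ (EuclideanSpace ℝ κ))
    {A : Matrix κ κ ℝ} (hA : A.PosSemidef) (v : ι → ℝ≥0) (hv0 : ∀ i, v i ≠ 0)
    (hv : ∀ i, A.mulVec (b i) = (v i : ℝ) • (b i).ofLp) :
    multivariateGaussian 0 A = (stdGaussian (EuclideanSpace ℝ κ)).withDensity fun x =>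
      ENNReal.ofReal (∏ i, gaussianRatio (v i) (b.repr x i)) := by
  classical
  have hint (i : ι) : Integrable (gaussianRatio (v i)) (gaussianReal 0 1) :=
    integrable_gaussianRatio (hv0 i)
  have hT : Measurable fun y : ι → ℝ => ∑ i, y i • b i := by fun_prop
  have hl : Measurable fun x : EuclideanSpace ℝ κ =>
      ENNReal.ofReal (∏ i, gaussianRatio (v i) (b.repr x i)) := by
    refine Measurable.ennreal_ofReal (Finset.measurable_prod _ fun i _ => ?_)
    exact (measurable_gaussianRatio _).comp (by fun_prop)
  rw [multivariateGaussian_eq_map_pi b hA v hv, stdGaussian_eq_map_pi_orthonormalBasis b]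
  simp_rw [fun i => gaussianReal_eq_withDensity_gaussianRatio (hv0 i)]
  rw [Measure.pi_withDensity _ _ hint fun i => gaussianRatio_nonneg _]
  ext s hs
  rw [Measure.map_apply hT hs, withDensity_apply _ (hT hs), withDensity_apply _ hs,
    setLIntegral_map hs hl hT]
  have (y : ι → ℝ) (i : ι) : b.repr (∑ i, y i • b i) i = y i := by
    simp [Pi.single_apply]
  simp only [this]

end Basis

/-! ### Chi-square divergence and moments of quadratic forms -/

section Spectral

variable {d : ℕ}

lemma frobeniusSq_nonneg (A : Matrix (Fin d) (Fin d) ℝ) : 0 ≤ frobeniusSq A :=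
  Finset.sum_nonneg fun _ _ => Finset.sum_nonneg fun _ _ => sq_nonneg _

lemma frobeniusSq_eq_sum_eigenvalues_sq {D : Matrix (Fin d) (Fin d) ℝ} (hD : D.IsHermitian) :
    frobeniusSq D = ∑ i, hD.eigenvalues i ^ 2 := by
  have h1 : frobeniusSq D = (D * D).trace := by
    simp only [frobeniusSq, Matrix.trace, Matrix.diag, Matrix.mul_apply]
    refine Finset.sum_congr rfl fun i _ => Finset.sum_congr rfl fun j _ => ?_
    have : D j i = D i j := by simpa using hD.apply i j
    rw [this, sq]
  have h2 : D * D = Unitary.conjStarAlgAut ℝ _ hD.eigenvectorUnitary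
      (Matrix.diagonal (fun i => hD.eigenvalues i ^ 2)) := by
    conv_lhs => rw [hD.spectral_theorem]
    rw [← map_mul, Matrix.diagonal_mul_diagonal]
    congr 2
    ext i
    simp [sq]
  rw [h1, h2, Unitary.conjStarAlgAut_apply, Matrix.trace_mul_cycle, Unitary.coe_star_mul_self,
    one_mul, Matrix.trace_diagonal]

lemma posSemidef_add_smul_one {D : Matrix (Fin d) (Fin d) ℝ} (hD : D.IsHermitian) (c : ℝ)
    (hc : ∀ i, 0 ≤ hD.eigenvalues i + c) : (D + c • (1 : Matrix (Fin d) (Fin d) ℝ)).PosSemidef := by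
  refine .of_dotProduct_mulVec_nonneg (hD.add ?_) fun x => ?_
  · simp [Matrix.IsHermitian]
  · have := dotProduct_mulVec_eq_sum hD.eigenvectorBasis (D + c • 1)
      (fun i => hD.eigenvalues i + c) (fun i => by
        rw [Matrix.add_mulVec, hD.mulVec_eigenvectorBasis, Matrix.smul_mulVec, Matrix.one_mulVec,
          add_smul]) (WithLp.toLp 2 x)
    simp only [star_trivial]
    rw [this]
    exact Finset.sum_nonneg fun i _ => mul_nonneg (hc i) (sq_nonneg _)

lemma abs_eigenvalues_le_half {D : Matrix (Fin d) (Fin d) ℝ} (hD : D.IsHermitian)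
    (hF : frobeniusSq D ≤ 1 / 4) (i : Fin d) : |hD.eigenvalues i| ≤ 1 / 2 := by
  rw [frobeniusSq_eq_sum_eigenvalues_sq hD] at hF
  have := (Finset.single_le_sum (f := fun i => hD.eigenvalues i ^ 2)
    (fun i _ => sq_nonneg _) (Finset.mem_univ i)).trans hF
  exact abs_le_of_sq_le_sq (by simpa using this.trans (by norm_num)) (by norm_num)

/-- Each eigenvalue of `S - 1` is bounded by its Frobenius norm, hence by `1/2`. -/
lemma wellConditioned_of_frobeniusSq_le {S : Matrix (Fin d) (Fin d) ℝ} (hD : (S - 1).IsHermitian)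
    (hF : frobeniusSq (S - 1) ≤ 1 / 4) : WellConditioned S := by
  have h (i : Fin d) := abs_le.1 (abs_eigenvalues_le_half hD hF i)
  constructor
  · have := posSemidef_add_smul_one hD (1 / 2) fun i => by linarith [(h i).1]
    convert this using 1
    ext i j
    simp only [Matrix.sub_apply, Matrix.add_apply, Matrix.smul_apply, smul_eq_mul]
    ring
  · refine .of_dotProduct_mulVec_nonneg ?_ fun x => ?_
    · have : (3 / 2 : ℝ) • (1 : Matrix (Fin d) (Fin d) ℝ) - S = (1 / 2 : ℝ) • 1 - (S - 1) := by
        ext i j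
        simp only [Matrix.sub_apply, Matrix.smul_apply, smul_eq_mul]
        ring
      rw [this]
      exact .sub (by simp [Matrix.IsHermitian]) hD
    · have := dotProduct_mulVec_eq_sum hD.eigenvectorBasis ((3 / 2 : ℝ) • 1 - S)
        (fun i => 1 / 2 - hD.eigenvalues i) (fun i => by
          have h1 := hD.mulVec_eigenvectorBasis i
          rw [Matrix.sub_mulVec, Matrix.one_mulVec, sub_eq_iff_eq_add] at h1
          rw [Matrix.sub_mulVec, h1, Matrix.smul_mulVec, Matrix.one_mulVec]
          module) (WithLp.toLp 2 x)
      simp only [star_trivial]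
      rw [this]
      exact Finset.sum_nonneg fun i _ => mul_nonneg (by linarith [(h i).2]) (sq_nonneg _)

lemma PrivateCovariance.WellConditioned.posSemidef {S : Matrix (Fin d) (Fin d) ℝ} (h : WellConditioned S) :
    S.PosSemidef := by
  have h1 : ((1 / 2 : ℝ) • (1 : Matrix (Fin d) (Fin d) ℝ)).PosSemidef :=
    Matrix.PosSemidef.one.smul (by norm_num)
  simpa using h.1.add h1

/-- A Gaussian measure whose covariance matrix is at Frobenius distance at most `1 / 2` from the
identity has a density with respect to the standard Gaussian measure, which is close to `1` in
mean square. -/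
lemma exists_density {S : Matrix (Fin d) (Fin d) ℝ} (hD : (S - 1).IsHermitian)
    (hF : frobeniusSq (S - 1) ≤ 1 / 4) :
    ∃ l : EuclideanSpace ℝ (Fin d) → ℝ, Measurable l ∧ (∀ x, 0 ≤ l x) ∧
      multivariateGaussian 0 S =
        (stdGaussian (EuclideanSpace ℝ (Fin d))).withDensity (fun x => ENNReal.ofReal (l x)) ∧
      Integrable l (stdGaussian _) ∧ ∫ x, l x ∂(stdGaussian _) = 1 ∧
      Integrable (fun x => (l x - 1) ^ 2) (stdGaussian _) ∧
      ∫ x, (l x - 1) ^ 2 ∂(stdGaussian _) ≤ 2 * frobeniusSq (S - 1) := by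
  set Q := stdGaussian (EuclideanSpace ℝ (Fin d)) with hQ
  have hS := WellConditioned.posSemidef (wellConditioned_of_frobeniusSq_le hD hF)
  have hle (i : Fin d) := abs_le.1 (abs_eigenvalues_le_half hD hF i)
  let v : Fin d → ℝ≥0 := fun i => (1 + hD.eigenvalues i).toNNReal
  have hv (i : Fin d) : (v i : ℝ) = 1 + hD.eigenvalues i :=
    Real.coe_toNNReal _ (by linarith [(hle i).1])
  have hv0 (i : Fin d) : v i ≠ 0 := by
    rw [← NNReal.coe_ne_zero, hv]; linarith [(hle i).1]
  have hev (i : Fin d) : S.mulVec (hD.eigenvectorBasis i) =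
      (v i : ℝ) • (hD.eigenvectorBasis i).ofLp := by
    have h1 := hD.mulVec_eigenvectorBasis i
    rw [Matrix.sub_mulVec, Matrix.one_mulVec, sub_eq_iff_eq_add] at h1
    rw [h1, hv]
    module
  let l : EuclideanSpace ℝ (Fin d) → ℝ :=
    fun x => ∏ i, gaussianRatio (v i) (hD.eigenvectorBasis.repr x i)
  have hlm : Measurable l :=
    Finset.measurable_prod _ fun i _ => (measurable_gaussianRatio _).comp (by fun_prop)
  have hl0 (x) : 0 ≤ l x := Finset.prod_nonneg fun i _ => gaussianRatio_nonneg _ _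
  have hl : multivariateGaussian 0 S = Q.withDensity (fun x => ENNReal.ofReal (l x)) :=
    multivariateGaussian_eq_withDensity hD.eigenvectorBasis hS v hv0 hev
  have hmp := measurePreserving_repr_stdGaussian hD.eigenvectorBasis
  have hsq (i : Fin d) := integral_gaussianRatio_sq (hv0 i) (by rw [hv]; linarith [(hle i).2])
  have hsqm : Measurable fun y : Fin d → ℝ => ∏ i, gaussianRatio (v i) (y i) ^ 2 :=
    Finset.measurable_prod _ fun i _ =>
      ((measurable_gaussianRatio _).comp (measurable_pi_apply i)).pow_const 2
  have hl2 (x) : l x ^ 2 = ∏ i, gaussianRatio (v i) (hD.eigenvectorBasis.repr x i) ^ 2 :=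
    (Finset.prod_pow _ _ _).symm
  have hl2i : Integrable (fun x => l x ^ 2) Q := by
    simp only [hl2]
    exact hmp.integrable_comp_of_integrable
      (Integrable.fintype_prod_dep (f := fun i z => gaussianRatio (v i) z ^ 2) fun i => (hsq i).1)
  -- The second moment factors over the eigenvalues `λ` of `S - 1` as the product of `(1 - λ ^ 2) ^
  -- (-1/2)`, each factor at most `exp (λ ^ 2)`.
  have hl2e : ∫ x, l x ^ 2 ∂Q ≤ Real.exp (frobeniusSq (S - 1)) := by
    simp only [hl2]
    have htr : ∫ x, ∏ i, gaussianRatio (v i) (hD.eigenvectorBasis.repr x i) ^ 2 ∂Q =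
        ∫ y : Fin d → ℝ, ∏ i, gaussianRatio (v i) (y i) ^ 2
          ∂Measure.pi fun _ => gaussianReal 0 1 :=
      hmp.hasLaw.integral_comp hsqm.aestronglyMeasurable
    rw [htr,
      integral_fintype_prod_eq_prod (fun i z => gaussianRatio (v i) z ^ 2),
      frobeniusSq_eq_sum_eigenvalues_sq hD, Real.exp_sum]
    refine Finset.prod_le_prod (fun i _ => integral_nonneg fun _ => sq_nonneg _) fun i _ => ?_
    rw [(hsq i).2, hv, add_sub_cancel_left]
    exact inv_sqrt_one_sub_sq_le (by nlinarith [hle i])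
  have hl1i : Integrable l Q :=
    ((memLp_two_iff_integrable_sq hlm.aestronglyMeasurable).2 hl2i).integrable one_le_two
  have hl1e : ∫ x, l x ∂Q = 1 := by
    have h1 : (multivariateGaussian 0 S) Set.univ = 1 := measure_univ
    rw [hl, withDensity_apply _ .univ, Measure.restrict_univ,
      ← ofReal_integral_eq_lintegral_ofReal hl1i (.of_forall hl0)] at h1
    simpa using h1
  have hexp (x) : (l x - 1) ^ 2 = l x ^ 2 - (2 * l x - 1) := by ring
  have hlin : Integrable (fun x => 2 * l x - 1) Q := (hl1i.const_mul 2).sub (integrable_const 1)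
  refine ⟨l, hlm, hl0, hl, hl1i, hl1e, ?_, ?_⟩
  · simp only [hexp]
    exact hl2i.sub hlin
  · simp only [hexp]
    rw [integral_sub hl2i hlin, integral_sub (hl1i.const_mul 2) (integrable_const 1),
      integral_const_mul, hl1e]
    simp only [integral_const, probReal_univ, smul_eq_mul, mul_one]
    have h0 := frobeniusSq_nonneg (S - 1)
    have := Real.abs_exp_sub_one_le (x := frobeniusSq (S - 1))
      (by rw [abs_of_nonneg h0]; linarith)
    rw [abs_of_nonneg h0] at this
    linarith [le_abs_self (Real.exp (frobeniusSq (S - 1)) - 1)]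

/-- The centered quadratic form of `D` has a fourth moment of the order of its squared variance
under the standard Gaussian measure. -/
lemma integral_quadForm_pow_four_le {D : Matrix (Fin d) (Fin d) ℝ} (hD : D.IsHermitian) :
    Integrable (fun x : EuclideanSpace ℝ (Fin d) => (x ⬝ᵥ D.mulVec x - D.trace) ^ 4)
        (stdGaussian _) ∧
      ∫ x : EuclideanSpace ℝ (Fin d), (x ⬝ᵥ D.mulVec x - D.trace) ^ 4 ∂(stdGaussian _) ≤
        14400 * frobeniusSq D ^ 2 := by
  set Q := stdGaussian (EuclideanSpace ℝ (Fin d)) with hQ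
  set e := hD.eigenvalues with he
  set F := frobeniusSq D with hFdef
  have hF : F = ∑ i, e i ^ 2 := frobeniusSq_eq_sum_eigenvalues_sq hD
  have hf (x : EuclideanSpace ℝ (Fin d)) : x ⬝ᵥ D.mulVec x - D.trace =
      ∑ i, e i * (hD.eigenvectorBasis.repr x i ^ 2 - 1) := by
    rw [dotProduct_mulVec_eq_sum hD.eigenvectorBasis D e hD.mulVec_eigenvectorBasis,
      hD.trace_eq_sum_eigenvalues]
    simp [mul_sub, Finset.sum_sub_distrib, he]
  have hmeas : Measurable fun x : EuclideanSpace ℝ (Fin d) => x ⬝ᵥ D.mulVec x - D.trace := by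
    simp only [hf]; fun_prop
  have hmp := measurePreserving_repr_stdGaussian hD.eigenvectorBasis
  rcases (frobeniusSq_nonneg D).eq_or_lt with h0 | hFpos
  · have he0 (i : Fin d) : e i = 0 := by
      have := (Finset.sum_eq_zero_iff_of_nonneg (fun i _ => sq_nonneg (e i))).1
        (hF.symm.trans h0.symm) i (Finset.mem_univ i)
      simpa using this
    simp [hf, he0, hFdef, ← h0]
  rw [← hFdef] at hFpos
  set r := √F with hr
  have hrpos : 0 < r := Real.sqrt_pos.2 hFpos
  have hr2 : r ^ 2 = F := Real.sq_sqrt hFpos.le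
  -- At `t = ± 1 / (4 √F)` all `|t e i|` are at most `1/4`, and the exponential moment is at most
  -- `exp (2 t ^ 2 F) = exp (1/8)`.
  have key (t : ℝ) (ht : t ^ 2 = 1 / (16 * F)) :
      Integrable (fun x : EuclideanSpace ℝ (Fin d) =>
        Real.exp (t * (x ⬝ᵥ D.mulVec x - D.trace))) Q ∧
      ∫ x : EuclideanSpace ℝ (Fin d), Real.exp (t * (x ⬝ᵥ D.mulVec x - D.trace)) ∂Q ≤ 8 / 7 := by
    have hte (i : Fin d) : |t * e i| ≤ 1 / 4 := by
      refine abs_le_of_sq_le_sq ?_ (by norm_num)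
      have : e i ^ 2 ≤ F := hF ▸ Finset.single_le_sum (f := fun i => e i ^ 2)
        (fun i _ => sq_nonneg _) (Finset.mem_univ i)
      rw [mul_pow, ht, one_div_mul_eq_div, div_le_iff₀ (by positivity)]
      linarith
    have hlt (i : Fin d) : t * e i < 1 / 2 := by linarith [(abs_le.1 (hte i)).2]
    have hx (x : EuclideanSpace ℝ (Fin d)) : Real.exp (t * (x ⬝ᵥ D.mulVec x - D.trace)) =
        ∏ i, Real.exp (-(t * e i)) *
          Real.exp (t * e i * hD.eigenvectorBasis.repr x i ^ 2) := by
      simp_rw [hf, ← Real.exp_add]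
      rw [← Real.exp_sum, Finset.mul_sum]
      congr 1
      refine Finset.sum_congr rfl fun i _ => ?_
      ring
    have hi (i : Fin d) : Integrable (fun z => Real.exp (-(t * e i)) * Real.exp (t * e i * z ^ 2))
        (gaussianReal 0 1) := (gaussianReal_exp_sq (hlt i)).1.const_mul _
    have hm : Measurable fun y : Fin d → ℝ =>
      ∏ i, Real.exp (-(t * e i)) * Real.exp (t * e i * y i ^ 2) := by fun_prop
    simp only [hx]
    refine ⟨hmp.integrable_comp_of_integrable (Integrable.fintype_prod_dep
      (f := fun i z => Real.exp (-(t * e i)) * Real.exp (t * e i * z ^ 2)) hi), ?_⟩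
    have htr : ∫ x, ∏ i, Real.exp (-(t * e i)) *
          Real.exp (t * e i * hD.eigenvectorBasis.repr x i ^ 2) ∂Q =
        ∫ y : Fin d → ℝ, ∏ i, Real.exp (-(t * e i)) * Real.exp (t * e i * y i ^ 2)
          ∂Measure.pi fun _ => gaussianReal 0 1 :=
      hmp.hasLaw.integral_comp hm.aestronglyMeasurable
    rw [htr,
      integral_fintype_prod_eq_prod
        (fun i z => Real.exp (-(t * e i)) * Real.exp (t * e i * z ^ 2))]
    calc ∏ i, ∫ z, Real.exp (-(t * e i)) * Real.exp (t * e i * z ^ 2) ∂gaussianReal 0 1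
        ≤ ∏ i, Real.exp (2 * (t * e i) ^ 2) := by
          refine Finset.prod_le_prod (fun i _ => integral_nonneg fun _ => by positivity)
            fun i _ => ?_
          rw [integral_const_mul, (gaussianReal_exp_sq (hlt i)).2]
          calc _ ≤ Real.exp (-(t * e i)) * Real.exp (t * e i + 2 * (t * e i) ^ 2) := by
                gcongr; exact inv_sqrt_one_sub_le (hte i)
            _ = _ := by rw [← Real.exp_add]; ring_nf
      _ = Real.exp (1 / 8) := by
          rw [← Real.exp_sum]
          congr 1
          simp_rw [mul_pow, ← Finset.mul_sum, ← hF, ht]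
          field_simp
          norm_num
      _ ≤ 8 / 7 := by
          have := Real.exp_bound_div_one_sub_of_interval (x := 1 / 8) (by norm_num) (by norm_num)
          exact this.trans (by norm_num)
  obtain ⟨hi1, hb1⟩ := key (1 / (4 * r)) (by rw [div_pow, mul_pow, hr2]; norm_num)
  obtain ⟨hi2, hb2⟩ := key (-(1 / (4 * r))) (by rw [neg_sq, div_pow, mul_pow, hr2]; norm_num)
  have hpt (x : EuclideanSpace ℝ (Fin d)) : (x ⬝ᵥ D.mulVec x - D.trace) ^ 4 ≤
      6144 * F ^ 2 * (Real.exp (1 / (4 * r) * (x ⬝ᵥ D.mulVec x - D.trace)) +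
        Real.exp (-(1 / (4 * r)) * (x ⬝ᵥ D.mulVec x - D.trace))) := by
    set y := x ⬝ᵥ D.mulVec x - D.trace
    -- The fourth moment is read off from `u ^ 4 / 4! ≤ exp |u|`; here `6144 = 24 · 4 ^ 4`, and
    -- finally `6144 · 2 · 8/7 < 14400`.
    have h1 : |1 / (4 * r) * y| ^ 4 / (Nat.factorial 4 : ℝ) ≤ Real.exp |1 / (4 * r) * y| :=
      Real.pow_div_factorial_le_exp _ (abs_nonneg _) 4
    have h2 : Real.exp |1 / (4 * r) * y| ≤
        Real.exp (1 / (4 * r) * y) + Real.exp (-(1 / (4 * r)) * y) := by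
      rw [neg_mul]
      rcases abs_choice (1 / (4 * r) * y) with h | h <;> rw [h] <;>
        linarith [Real.exp_pos (1 / (4 * r) * y), Real.exp_pos (-(1 / (4 * r) * y))]
    have h3 : |1 / (4 * r) * y| ^ 4 = y ^ 4 / (256 * F ^ 2) := by
      rw [← hr2]
      have : |1 / (4 * r) * y| ^ 4 = (1 / (4 * r) * y) ^ 4 := by
        rw [pow_abs, abs_of_nonneg (by positivity)]
      rw [this]
      field_simp
      ring
    rw [h3] at h1
    have h4 : (Nat.factorial 4 : ℝ) = 24 := by norm_num [Nat.factorial]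
    rw [h4, div_div, div_le_iff₀ (by positivity)] at h1
    nlinarith [mul_le_mul_of_nonneg_left h2 (show 0 ≤ 6144 * F ^ 2 by positivity)]
  have hint := ((hi1.add hi2).const_mul (6144 * F ^ 2))
  have hint4 : Integrable (fun x : EuclideanSpace ℝ (Fin d) =>
      (x ⬝ᵥ D.mulVec x - D.trace) ^ 4) Q := by
    refine hint.mono' (hmeas.pow_const 4).aestronglyMeasurable (.of_forall fun x => ?_)
    rw [Real.norm_eq_abs, abs_of_nonneg (by positivity)]
    exact hpt x
  refine ⟨hint4, (integral_mono hint4 hint hpt).trans ?_⟩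
  simp only [Pi.add_apply]
  rw [integral_const_mul, integral_add hi1 hi2]
  nlinarith [sq_nonneg F]

/-- For `D = S - T`, subtracting this mean for `T` from that for `S` leaves the squared Frobenius
norm of `D`. -/
lemma integral_quadForm_multivariateGaussian {S : Matrix (Fin d) (Fin d) ℝ} (hS : S.PosSemidef)
    (D : Matrix (Fin d) (Fin d) ℝ) :
    Integrable (fun x : EuclideanSpace ℝ (Fin d) => x ⬝ᵥ D.mulVec x)
        (multivariateGaussian 0 S) ∧
      ∫ x : EuclideanSpace ℝ (Fin d), x ⬝ᵥ D.mulVec x ∂(multivariateGaussian 0 S) =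
        ∑ i, ∑ j, D i j * S i j := by
  set N := multivariateGaussian (0 : EuclideanSpace ℝ (Fin d)) S with hN
  have hL (i : Fin d) : MemLp (fun x : EuclideanSpace ℝ (Fin d) => x i) 2 N :=
    (IsGaussian.memLp_two_id (μ := N)).continuousLinearMap_comp
      (EuclideanSpace.proj i : EuclideanSpace ℝ (Fin d) →L[ℝ] ℝ)
  have hI (i j : Fin d) : Integrable (fun x : EuclideanSpace ℝ (Fin d) => x i * x j) N :=
    (hL i).integrable_mul (hL j)
  have h0 (i : Fin d) : ∫ x : EuclideanSpace ℝ (Fin d), x i ∂N = 0 := by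
    have := ContinuousLinearMap.integral_comp_comm
      (EuclideanSpace.proj (𝕜 := ℝ) i : EuclideanSpace ℝ (Fin d) →L[ℝ] ℝ)
      (IsGaussian.integrable_id (μ := N))
    simpa [hN] using this
  have hE (i j : Fin d) : ∫ x : EuclideanSpace ℝ (Fin d), x i * x j ∂N = S i j := by
    have := covariance_eval_multivariateGaussian (μ := 0) hS i j
    rw [← hN, covariance_eq_sub (hL i) (hL j), h0, h0] at this
    simpa using this
  have hx (x : EuclideanSpace ℝ (Fin d)) :
      x ⬝ᵥ D.mulVec x = ∑ i, ∑ j, D i j * (x i * x j) := by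
    simp only [dotProduct, Matrix.mulVec, Finset.mul_sum]
    refine Finset.sum_congr rfl fun i _ => Finset.sum_congr rfl fun j _ => ?_
    ring
  have hDI (i j : Fin d) :
      Integrable (fun x : EuclideanSpace ℝ (Fin d) => D i j * (x i * x j)) N :=
    (hI i j).const_mul _
  simp only [hx]
  refine ⟨integrable_finsetSum _ fun i _ => integrable_finsetSum _ fun j _ => hDI i j, ?_⟩
  refine (integral_finsetSum _ fun i _ => integrable_finsetSum _ fun j _ => hDI i j).trans
    (Finset.sum_congr rfl fun i _ => (integral_finsetSum _ fun j _ => hDI i j).trans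
      (Finset.sum_congr rfl fun j _ => ?_))
  rw [integral_const_mul, hE]

end Spectral

/-! ### Total variation separation, coupling and packing of Gaussians -/

section Separation

variable {d : ℕ}

lemma integral_withDensity_ofReal {E : Type*} [MeasurableSpace E] {Q : Measure E} {l : E → ℝ}
    (hl : Measurable l) (h0 : ∀ x, 0 ≤ l x) (f : E → ℝ) :
    ∫ x, f x ∂(Q.withDensity fun x => ENNReal.ofReal (l x)) = ∫ x, l x * f x ∂Q := by
  rw [integral_withDensity_eq_integral_toReal_smul hl.ennreal_ofReal (by simp)]
  simp [ENNReal.toReal_ofReal (h0 _)]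

lemma integrable_withDensity_ofReal_iff {E : Type*} [MeasurableSpace E] {Q : Measure E} {l : E → ℝ}
    (hl : Measurable l) (h0 : ∀ x, 0 ≤ l x) (f : E → ℝ) :
    Integrable f (Q.withDensity fun x => ENNReal.ofReal (l x)) ↔
      Integrable (fun x => l x * f x) Q := by
  rw [integrable_withDensity_iff_integrable_smul' hl.ennreal_ofReal (by simp)]
  simp [ENNReal.toReal_ofReal (h0 _)]

/-- Two Gaussian measures whose covariance matrices are close to the identity and separated in
Frobenius norm are separated in total variation. -/
lemma exists_distinguishing_set {S T : Matrix (Fin d) (Fin d) ℝ} (hS : (S - 1).IsHermitian)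
    (hT : (T - 1).IsHermitian) {ρ : ℝ} (hρ : 0 < ρ) (hρ2 : ρ ≤ 1 / 2)
    (hSF : frobeniusSq (S - 1) ≤ ρ ^ 2) (hTF : frobeniusSq (T - 1) ≤ ρ ^ 2)
    (hST : 4 / 5 * ρ ^ 2 ≤ frobeniusSq (S - T)) :
    ∃ A : Set (EuclideanSpace ℝ (Fin d)), MeasurableSet A ∧
      ρ / 850 ≤ (multivariateGaussian 0 S).real A - (multivariateGaussian 0 T).real A := by
  set Q := stdGaussian (EuclideanSpace ℝ (Fin d)) with hQ
  have hρ4 : ρ ^ 2 ≤ 1 / 4 := by nlinarith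
  obtain ⟨l, hlm, hl0, hl, hli, hl1, hlv, hlV⟩ := exists_density hS (hSF.trans hρ4)
  obtain ⟨k, hkm, hk0, hk, hki, hk1, hkv, hkV⟩ := exists_density hT (hTF.trans hρ4)
  have hSp := WellConditioned.posSemidef (wellConditioned_of_frobeniusSq_le hS (hSF.trans hρ4))
  have hTp := WellConditioned.posSemidef (wellConditioned_of_frobeniusSq_le hT (hTF.trans hρ4))
  set D := S - T with hDdef
  have hD : D.IsHermitian := by
    have := hS.sub hT
    rwa [sub_sub_sub_cancel_right] at this
  set F := frobeniusSq D with hF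
  have hFpos : 0 < F := lt_of_lt_of_le (by positivity) hST
  set f : EuclideanSpace ℝ (Fin d) → ℝ := fun x => x ⬝ᵥ D.mulVec x - D.trace with hf
  obtain ⟨hf4i, hf4⟩ := integral_quadForm_pow_four_le hD
  obtain ⟨hqSi, hqS⟩ := integral_quadForm_multivariateGaussian hSp D
  obtain ⟨hqTi, hqT⟩ := integral_quadForm_multivariateGaussian hTp D
  have hlf : Integrable (fun x => l x * f x) Q := by
    rw [← integrable_withDensity_ofReal_iff hlm hl0, ← hl]
    exact hqSi.sub (integrable_const _)
  have hkf : Integrable (fun x => k x * f x) Q := by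
    rw [← integrable_withDensity_ofReal_iff hkm hk0, ← hk]
    exact hqTi.sub (integrable_const _)
  have hmean : ∫ x, (l x * f x - k x * f x) ∂Q = F := by
    rw [integral_sub hlf hkf, ← integral_withDensity_ofReal hlm hl0,
      ← integral_withDensity_ofReal hkm hk0, ← hl, ← hk, hf,
      integral_sub hqSi (integrable_const _), integral_sub hqTi (integrable_const _), hqS, hqT]
    simp only [integral_const, probReal_univ, smul_eq_mul, one_mul]
    rw [sub_sub_sub_cancel_right, hF, frobeniusSq, ← Finset.sum_sub_distrib]
    refine Finset.sum_congr rfl fun i _ => ?_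
    rw [← Finset.sum_sub_distrib]
    refine Finset.sum_congr rfl fun j _ => ?_
    rw [hDdef, Matrix.sub_apply]
    ring
  have hhi : Integrable (fun x => |l x - k x|) Q := (hli.sub hki).abs
  -- Two weighted AM-GM steps bound `F = ∫ (l - k) f` by `a ∫ |l - k|` plus terms in the chi-square
  -- divergences and the fourth moment of `f`. These weights make the extra terms at most `F / 2`.
  set a := 170 * ρ with ha
  set b := 20 * F / ρ with hb
  have hapos : 0 < a := by positivity
  have hbpos : 0 < b := by positivity
  have hpt (x : EuclideanSpace ℝ (Fin d)) : l x * f x - k x * f x ≤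
      a * |l x - k x| + (4 * a)⁻¹ *
        (b * (2 * (l x - 1) ^ 2 + 2 * (k x - 1) ^ 2) + (4 * b)⁻¹ * f x ^ 4) := by
    set h := |l x - k x| with hh
    have hh0 : 0 ≤ h := abs_nonneg _
    have hh2 : h ^ 2 ≤ 2 * (l x - 1) ^ 2 + 2 * (k x - 1) ^ 2 := by
      rw [hh, sq_abs]; nlinarith [sq_nonneg (l x - 1 + (k x - 1))]
    have amgm (c u v : ℝ) (hc : 0 < c) : u * v ≤ c * u ^ 2 + (4 * c)⁻¹ * v ^ 2 := by
      have : c * u ^ 2 + (4 * c)⁻¹ * v ^ 2 - u * v = (4 * c)⁻¹ * (2 * c * u - v) ^ 2 := by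
        field_simp; ring
      have : 0 ≤ (4 * c)⁻¹ * (2 * c * u - v) ^ 2 := by positivity
      linarith
    have h1 : l x * f x - k x * f x ≤ h * |f x| := by
      rw [← sub_mul, hh, ← abs_mul]; exact le_abs_self _
    have h2 : h * |f x| ≤ a * h + (4 * a)⁻¹ * (h * f x ^ 2) := by
      have := mul_le_mul_of_nonneg_left (amgm a 1 |f x| hapos) hh0
      rw [sq_abs] at this
      linarith
    have h3 : h * f x ^ 2 ≤ b * h ^ 2 + (4 * b)⁻¹ * f x ^ 4 := by
      have := amgm b h (f x ^ 2) hbpos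
      rwa [← pow_mul] at this
    have h4 : h * f x ^ 2 ≤
        b * (2 * (l x - 1) ^ 2 + 2 * (k x - 1) ^ 2) + (4 * b)⁻¹ * f x ^ 4 :=
      h3.trans (by gcongr)
    refine h1.trans (h2.trans ?_)
    gcongr
  have hvi : Integrable (fun x => 2 * (l x - 1) ^ 2 + 2 * (k x - 1) ^ 2) Q :=
    (hlv.const_mul 2).add (hkv.const_mul 2)
  have hri : Integrable (fun x => b * (2 * (l x - 1) ^ 2 + 2 * (k x - 1) ^ 2) +
      (4 * b)⁻¹ * f x ^ 4) Q := (hvi.const_mul b).add (hf4i.const_mul _)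
  have hint := integral_mono (hlf.sub hkf) ((hhi.const_mul a).add (hri.const_mul (4 * a)⁻¹)) hpt
  simp only [Pi.sub_apply, Pi.add_apply] at hint
  rw [hmean, integral_add (hhi.const_mul a) (hri.const_mul _), integral_const_mul,
    integral_const_mul, integral_add (hvi.const_mul b) (hf4i.const_mul _), integral_const_mul,
    integral_const_mul, integral_add (hlv.const_mul 2) (hkv.const_mul 2), integral_const_mul,
    integral_const_mul] at hint
  set H := ∫ x, |l x - k x| ∂Q with hH
  have hHlow : ρ / 425 ≤ H := by
    have h1 : (4 * a)⁻¹ * (b * (2 * ∫ x, (l x - 1) ^ 2 ∂Q + 2 * ∫ x, (k x - 1) ^ 2 ∂Q) +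
        (4 * b)⁻¹ * ∫ x, f x ^ 4 ∂Q) ≤
        (4 * a)⁻¹ * (b * (2 * (2 * ρ ^ 2) + 2 * (2 * ρ ^ 2)) +
        (4 * b)⁻¹ * (14400 * F ^ 2)) := by
      gcongr
      · linarith
      · linarith
    have h2 : (4 * a)⁻¹ * (b * (2 * (2 * ρ ^ 2) + 2 * (2 * ρ ^ 2)) +
        (4 * b)⁻¹ * (14400 * F ^ 2)) = F / 2 := by
      rw [ha, hb]; field_simp; ring
    have h3 : F / 2 ≤ 170 * ρ * H := by rw [h2] at h1; linarith
    have h4 : ρ * (ρ / 425) ≤ ρ * H := by nlinarith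
    exact le_of_mul_le_mul_left h4 hρ
  set A := {x | k x < l x} with hA
  have hAm : MeasurableSet A := measurableSet_lt hkm hlm
  have hreal (g : EuclideanSpace ℝ (Fin d) → ℝ) (hg : Measurable g) (hg0 : ∀ x, 0 ≤ g x)
      (N : Measure (EuclideanSpace ℝ (Fin d)))
      (hN : N = Q.withDensity fun x => ENNReal.ofReal (g x)) :
      N.real A = ∫ x, A.indicator g x ∂Q := by
    have h1 := integral_withDensity_ofReal (Q := Q) hg hg0 (A.indicator fun _ => 1)
    rw [← hN, integral_indicator_const _ hAm, smul_eq_mul, mul_one] at h1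
    rw [h1]
    congr 1; ext x
    by_cases hx : x ∈ A <;> simp [hx]
  refine ⟨A, hAm, ?_⟩
  rw [hreal l hlm hl0 _ hl, hreal k hkm hk0 _ hk,
    ← integral_sub (hli.indicator hAm) (hki.indicator hAm)]
  -- Both densities have integral `1`, so the gap on `A` is half the `L¹` distance.
  have h2 : H = 2 * ∫ x, (A.indicator l x - A.indicator k x) ∂Q - ∫ x, (l x - k x) ∂Q := by
    have hi1 : Integrable (fun x => 2 * (A.indicator l x - A.indicator k x)) Q :=
      ((hli.indicator hAm).sub (hki.indicator hAm)).const_mul 2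
    have hi2 : Integrable (fun x => l x - k x) Q := hli.sub hki
    rw [← integral_const_mul, ← integral_sub hi1 hi2]
    refine integral_congr_ae (.of_forall fun x => ?_)
    beta_reduce
    by_cases hx : k x < l x
    · simp only [A, Set.indicator, Set.mem_ofPred_eq, hx, if_true, abs_of_pos (sub_pos.2 hx)]
      ring
    · simp only [A, Set.indicator, Set.mem_ofPred_eq, hx, if_false,
        abs_of_nonpos (sub_nonpos.2 (not_lt.1 hx))]
      ring
  rw [integral_sub hli hki, hl1, hk1] at h2
  linarith

/-- A Gaussian measure whose covariance matrix is close to the identity can be coupled with the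
standard Gaussian measure. -/
lemma exists_gaussian_coupling {S : Matrix (Fin d) (Fin d) ℝ} (hS : (S - 1).IsHermitian)
    {ρ : ℝ} (hρ : 0 < ρ) (hρ2 : ρ ≤ 1 / 2) (hSF : frobeniusSq (S - 1) ≤ ρ ^ 2) :
    ∃ γ : Measure (EuclideanSpace ℝ (Fin d) × EuclideanSpace ℝ (Fin d)),
      IsProbabilityMeasure γ ∧ γ.map Prod.fst = multivariateGaussian 0 S ∧
      γ.map Prod.snd = stdGaussian (EuclideanSpace ℝ (Fin d)) ∧
      γ {z | z.1 ≠ z.2} ≤ ENNReal.ofReal (3 / 2 * ρ) := by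
  have hρ4 : ρ ^ 2 ≤ 1 / 4 := by nlinarith
  obtain ⟨l, hlm, hl0, hl, hli, hl1, hlv, hlV⟩ := exists_density hS (hSF.trans hρ4)
  set Q := stdGaussian (EuclideanSpace ℝ (Fin d)) with hQ
  have : IsProbabilityMeasure (Q.withDensity fun x => ENNReal.ofReal (l x)) := by
    rw [← hl]; infer_instance
  obtain ⟨γ, hγ, h1, h2, h3⟩ := exists_coupling_withDensity Q _ hlm.ennreal_ofReal
  refine ⟨γ, hγ, h1.trans hl.symm, h2, h3.trans ?_⟩
  have hgi : Integrable (fun x => (2 * ρ)⁻¹ * (l x - 1) ^ 2 + ρ / 2) Q :=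
    (hlv.const_mul _).add (integrable_const _)
  calc ∫⁻ x, (1 - ENNReal.ofReal (l x)) ∂Q
      ≤ ∫⁻ x, ENNReal.ofReal ((2 * ρ)⁻¹ * (l x - 1) ^ 2 + ρ / 2) ∂Q := by
        refine lintegral_mono fun x => ?_
        rw [← ENNReal.ofReal_one, ← ENNReal.ofReal_sub _ (hl0 x)]
        refine ENNReal.ofReal_le_ofReal ?_
        -- AM-GM in place of Cauchy–Schwarz: the chi-square bound `2 ρ ^ 2` contributes `ρ`, the
        -- constant contributes `ρ / 2`.
        have : (2 * ρ)⁻¹ * (l x - 1) ^ 2 + ρ / 2 - (1 - l x) =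
            (2 * ρ)⁻¹ * (l x - 1 + ρ) ^ 2 := by field_simp; ring
        have : 0 ≤ (2 * ρ)⁻¹ * (l x - 1 + ρ) ^ 2 := by positivity
        linarith
    _ = ENNReal.ofReal (∫ x, ((2 * ρ)⁻¹ * (l x - 1) ^ 2 + ρ / 2) ∂Q) := by
        rw [ofReal_integral_eq_lintegral_ofReal hgi (.of_forall fun x => by positivity)]
    _ ≤ ENNReal.ofReal (3 / 2 * ρ) := by
        refine ENNReal.ofReal_le_ofReal ?_
        rw [integral_add (hlv.const_mul _) (integrable_const _), integral_const_mul]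
        simp only [integral_const, probReal_univ, smul_eq_mul, one_mul]
        have : (2 * ρ)⁻¹ * ∫ x, (l x - 1) ^ 2 ∂Q ≤ (2 * ρ)⁻¹ * (2 * ρ ^ 2) := by
          gcongr; linarith
        have h5 : (2 * ρ)⁻¹ * (2 * ρ ^ 2) = ρ := by field_simp
        linarith

/-- A packing of exponential size in `d ^ 2`, in Frobenius norm, of the set of covariance matrices
at distance `ρ` from the identity. -/
lemma exists_covariance_packing (d : ℕ) (hd : 0 < d) (ρ : ℝ) :
    ∃ (C : Finset (Sym2 (Fin d) → Bool))
      (S : (Sym2 (Fin d) → Bool) → Matrix (Fin d) (Fin d) ℝ),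
      (∀ a, (S a - 1).IsHermitian ∧ frobeniusSq (S a - 1) = ρ ^ 2) ∧
      (∀ a ∈ C, ∀ b ∈ C, a ≠ b → 4 / 5 * ρ ^ 2 ≤ frobeniusSq (S a - S b)) ∧
      (d : ℝ) ^ 2 / 120 ≤ Real.log C.card := by
  obtain ⟨C, hC, hlog⟩ := exists_separated_code (Sym2 (Fin d))
  have hd' : (0 : ℝ) < d := by exact_mod_cast hd
  have hcard : (d : ℝ) ^ 2 / 2 ≤ Fintype.card (Sym2 (Fin d)) := by
    rw [Sym2.card, Fintype.card_fin, Nat.cast_choose_two]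
    push_cast
    nlinarith
  -- Indexing signs by `Sym2` forces symmetry; all `d ^ 2` entries have modulus `ρ / d`, so the
  -- Frobenius norm is exactly `|ρ|`.
  let S : (Sym2 (Fin d) → Bool) → Matrix (Fin d) (Fin d) ℝ := fun a =>
    1 + Matrix.of fun i j => ρ / d * if a s(i, j) then 1 else -1
  refine ⟨C, S, fun a => ⟨?_, ?_⟩, fun a ha b hb hab => ?_, ?_⟩
  · ext i j
    simp [S, Sym2.eq_swap]
  · simp only [S, add_sub_cancel_left, frobeniusSq, Matrix.of_apply, mul_pow, ite_pow, one_pow,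
      even_two.neg_pow, ite_self, mul_one, Finset.sum_const, Finset.card_univ, Fintype.card_fin,
      nsmul_eq_mul]
    field_simp
  · have h1 : frobeniusSq (S a - S b) =
        4 * (ρ / d) ^ 2 * (Finset.univ.filter fun p : Fin d × Fin d =>
          a s(p.1, p.2) ≠ b s(p.1, p.2)).card := by
      rw [frobeniusSq, ← Finset.sum_product', Finset.univ_product_univ, mul_comm,
        ← nsmul_eq_mul, ← Finset.sum_const, Finset.sum_filter]
      refine Finset.sum_congr rfl fun p _ => ?_
      rcases Bool.eq_false_or_eq_true (a s(p.1, p.2)) with h | h <;>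
        rcases Bool.eq_false_or_eq_true (b s(p.1, p.2)) with h' | h' <;> simp [S, h, h'] <;> ring
    -- Each differing unordered pair is hit by at least one matrix entry; the double count off the
    -- diagonal is not exploited.
    have h2 : hammingDist a b ≤ (Finset.univ.filter fun p : Fin d × Fin d =>
        a s(p.1, p.2) ≠ b s(p.1, p.2)).card := by
      refine Finset.card_le_card_of_surjOn (fun p => s(p.1, p.2)) fun e he => ?_
      induction e using Sym2.ind with
      | _ i j => exact ⟨(i, j), by simpa using he, rfl⟩
    have h3 : (hammingDist a b : ℝ) ≤ (Finset.univ.filter fun p : Fin d × Fin d =>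
        a s(p.1, p.2) ≠ b s(p.1, p.2)).card := by exact_mod_cast h2
    have h4 := hC a ha b hb hab
    rw [h1]
    calc 4 / 5 * ρ ^ 2 = 4 * (ρ / d) ^ 2 * (2 / 5 * ((d : ℝ) ^ 2 / 2)) := by field_simp
      _ ≤ _ := by gcongr; linarith
  · linarith

/-- A differentially private mechanism which identifies the elements of a packing of covariance
matrices needs many samples. -/
lemma PrivateCovariance.IsDP.sample_size_ge {Y : Type*} [MeasurableSpace Y] {n : ℕ} (hd : 0 < d)
    {ε ρ : ℝ} (hε : 0 < ε) (hρ : 0 < ρ) (hρ2 : ρ ≤ 1 / 2)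
    {M : Kernel (Fin n → EuclideanSpace ℝ (Fin d)) Y} [IsMarkovKernel M] (hM : IsDP M ε 0)
    {C : Finset (Sym2 (Fin d) → Bool)} {S : (Sym2 (Fin d) → Bool) → Matrix (Fin d) (Fin d) ℝ}
    (hS : ∀ a, (S a - 1).IsHermitian ∧ frobeniusSq (S a - 1) = ρ ^ 2)
    (hC : (d : ℝ) ^ 2 / 120 ≤ Real.log C.card)
    (T : (Sym2 (Fin d) → Bool) → Set Y) (hT : ∀ a ∈ C, MeasurableSet (T a))
    (hdisj : (C : Set (Sym2 (Fin d) → Bool)).PairwiseDisjoint T)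
    (hsucc : ∀ a ∈ C, 2 / 3 ≤ (M ∘ₘ gaussianSamples n (S a)) (T a)) :
    (d : ℝ) ^ 2 / (17280 * (ρ * ε)) ≤ n := by
  have hd' : (0 : ℝ) < d := by exact_mod_cast hd
  have := hM.log_card_le hε C (fun a => multivariateGaussian 0 (S a))
    (stdGaussian (EuclideanSpace ℝ (Fin d))) T hT hdisj (p := 3 / 2 * ρ) (by positivity)
    (fun a _ => exists_gaussian_coupling (hS a).1 hρ hρ2 (hS a).2.le) hsucc
    (lt_of_lt_of_le (by positivity) hC)
  rw [div_le_iff₀ (by positivity)]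
  linarith

end Separation

/-! ### The two lower bounds -/

section Mechanisms

variable {n d : ℕ} {ε α : ℝ}

lemma abs_sub_le_tvDist {Ω : Type*} [MeasurableSpace Ω] (P Q : Measure Ω) [IsProbabilityMeasure P]
    [IsProbabilityMeasure Q] {A : Set Ω} (hA : MeasurableSet A) :
    |P.real A - Q.real A| ≤ tvDist P Q := by
  refine le_ciSup (f := fun A : {A : Set Ω // MeasurableSet A} => |P.real A.1 - Q.real A.1|)
    ⟨1, ?_⟩ ⟨A, hA⟩
  rintro _ ⟨B, rfl⟩
  have h1 : P.real B.1 ≤ 1 := measureReal_le_one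
  have h2 : Q.real B.1 ≤ 1 := measureReal_le_one
  have h3 : 0 ≤ P.real B.1 := measureReal_nonneg
  have h4 : 0 ≤ Q.real B.1 := measureReal_nonneg
  exact abs_le.2 ⟨by linarith, by linarith⟩

lemma measurable_real_probabilityMeasure {Ω : Type*} [MeasurableSpace Ω] {A : Set Ω}
    (hA : MeasurableSet A) :
    Measurable fun Q : ProbabilityMeasure Ω => (Q : Measure Ω).real A :=
  ((Measure.measurable_coe hA).comp measurable_subtype_coe).ennreal_toReal

lemma PrivateCovariance.LearnsGaussian.sample_size_ge (hd : 0 < d) (hε : 0 < ε) (hα : 0 < α)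
    (hα0 : α ≤ 1 / 4000)
    {M : Kernel (Fin n → EuclideanSpace ℝ (Fin d)) (ProbabilityMeasure (EuclideanSpace ℝ (Fin d)))}
    [IsMarkovKernel M] (hM : IsDP M ε 0) (hL : LearnsGaussian M α) :
    1 / 34560000 * ((d : ℝ) ^ 2 / (α * ε)) ≤ n := by
  -- The separation `ρ / 850` then exceeds `2 α`, and `α ≤ 1 / 4000` keeps `ρ ≤ 1/2`.
  set ρ := 2000 * α with hρ
  have hρpos : 0 < ρ := by positivity
  have hρ2 : ρ ≤ 1 / 2 := by rw [hρ]; linarith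
  obtain ⟨C, S, hS, hsep, hC⟩ := exists_covariance_packing d hd ρ
  have hA (a b : Sym2 (Fin d) → Bool) : ∃ A : Set (EuclideanSpace ℝ (Fin d)), MeasurableSet A ∧
      (a ∈ C → b ∈ C → a ≠ b → 2 * α <
        (multivariateGaussian 0 (S a)).real A - (multivariateGaussian 0 (S b)).real A) := by
    by_cases h : a ∈ C ∧ b ∈ C ∧ a ≠ b
    · obtain ⟨A, hAm, hA⟩ := exists_distinguishing_set (hS a).1 (hS b).1 hρpos hρ2 (hS a).2.le
        (hS b).2.le (hsep a h.1 b h.2.1 h.2.2)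
      exact ⟨A, hAm, fun _ _ _ => by linarith⟩
    · exact ⟨∅, .empty, fun h1 h2 h3 => absurd ⟨h1, h2, h3⟩ h⟩
  choose A hAm hA using hA
  -- The total variation ball is enlarged to a condition on finitely many test sets: this is
  -- measurable and still keeps the events disjoint.
  let T : (Sym2 (Fin d) → Bool) → Set (ProbabilityMeasure (EuclideanSpace ℝ (Fin d))) := fun a =>
    {Q | ∀ b c, |(multivariateGaussian 0 (S a)).real (A b c) -
      (Q : Measure (EuclideanSpace ℝ (Fin d))).real (A b c)| ≤ α}
  have hT (a : Sym2 (Fin d) → Bool) : MeasurableSet (T a) := by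
    have : T a = ⋂ b, ⋂ c, {Q : ProbabilityMeasure (EuclideanSpace ℝ (Fin d)) |
        |(multivariateGaussian 0 (S a)).real (A b c) -
        (Q : Measure (EuclideanSpace ℝ (Fin d))).real (A b c)| ≤ α} := by
      ext; simp [T]
    rw [this]
    refine .iInter fun b => .iInter fun c => measurableSet_le ?_ measurable_const
    exact (measurable_const.sub (measurable_real_probabilityMeasure (hAm b c))).abs
  have hdisj : (C : Set (Sym2 (Fin d) → Bool)).PairwiseDisjoint T := by
    intro a ha b hb hab
    refine Set.disjoint_left.2 fun Q hQa hQb => ?_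
    have h1 := abs_le.1 (hQa a b)
    have h2 := abs_le.1 (hQb a b)
    have h3 := hA a b ha hb hab
    linarith [h1.2, h2.1]
  have hsucc (a : Sym2 (Fin d) → Bool) :
      2 / 3 ≤ (M ∘ₘ gaussianSamples n (S a)) (T a) := by
    have hρ4 : ρ ^ 2 ≤ 1 / 4 := by nlinarith
    refine (hL (S a) (wellConditioned_of_frobeniusSq_le (hS a).1
      ((hS a).2.le.trans hρ4))).trans (measure_mono fun Q hQ b c => ?_)
    exact (abs_sub_le_tvDist _ _ (hAm b c)).trans hQ
  have := hM.sample_size_ge hd hε hρpos hρ2 hS hC T (fun a _ => hT a) hdisj fun a _ => hsucc a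
  refine le_trans (le_of_eq ?_) this
  rw [hρ]
  field_simp
  norm_num

lemma frobeniusSq_sub_le (A B D : Matrix (Fin d) (Fin d) ℝ) :
    frobeniusSq (B - D) ≤ 2 * frobeniusSq (A - B) + 2 * frobeniusSq (A - D) := by
  simp only [frobeniusSq, Finset.mul_sum, ← Finset.sum_add_distrib, Matrix.sub_apply]
  refine Finset.sum_le_sum fun i _ => Finset.sum_le_sum fun j _ => ?_
  nlinarith [sq_nonneg (A i j - B i j + (A i j - D i j))]

lemma measurable_frobeniusSq_sub (S : Matrix (Fin d) (Fin d) ℝ) :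
    Measurable fun A : PSDMatrix d => frobeniusSq (A.1 - S) := by
  have h : Measurable fun (A : PSDMatrix d) (i j : Fin d) => A.1 i j := comap_measurable _
  have h' (i j : Fin d) : Measurable fun A : PSDMatrix d => A.1 i j :=
    (measurable_pi_apply j).comp ((measurable_pi_apply i).comp h)
  refine Finset.measurable_sum _ fun i _ => Finset.measurable_sum _ fun j _ => ?_
  exact ((h' i j).sub_const _).pow_const 2

lemma PrivateCovariance.EstimatesCovariance.sample_size_ge (hd : 0 < d) (hε : 0 < ε)
    (hα : 0 < α) (hα1 : α ≤ 1)
    {M : Kernel (Fin n → EuclideanSpace ℝ (Fin d)) (PSDMatrix d)} [IsMarkovKernel M]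
    (hM : IsDP M ε 0) (hE : EstimatesCovariance M (α ^ 2 / 64)) :
    1 / 8640 * ((d : ℝ) ^ 2 / (α * ε)) ≤ n := by
  set ρ := α / 2 with hρ
  have hρpos : 0 < ρ := by positivity
  have hρ2 : ρ ≤ 1 / 2 := by rw [hρ]; linarith
  obtain ⟨C, S, hS, hsep, hC⟩ := exists_covariance_packing d hd ρ
  -- Three times the allowed error, so Markov's inequality fails with probability at most `1/3`;
  -- disjointness holds because `4 τ = 3 α ^ 2 / 16` is below the separation `α ^ 2 / 5`.
  set τ := 3 * α ^ 2 / 64 with hτ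
  have hτpos : 0 < τ := by positivity
  let T : (Sym2 (Fin d) → Bool) → Set (PSDMatrix d) := fun a => {A | frobeniusSq (A.1 - S a) < τ}
  have hT (a : Sym2 (Fin d) → Bool) : MeasurableSet (T a) :=
    measurableSet_lt (measurable_frobeniusSq_sub _) measurable_const
  have hdisj : (C : Set (Sym2 (Fin d) → Bool)).PairwiseDisjoint T := by
    intro a ha b hb hab
    refine Set.disjoint_left.2 fun A hAa hAb => ?_
    have h1 := frobeniusSq_sub_le A.1 (S a) (S b)
    have h2 := hsep a ha b hb hab
    have h3 : frobeniusSq (A.1 - S a) < τ := hAa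
    have h4 : frobeniusSq (A.1 - S b) < τ := hAb
    nlinarith [sq_nonneg α]
  have hsucc (a : Sym2 (Fin d) → Bool) :
      2 / 3 ≤ (M ∘ₘ gaussianSamples n (S a)) (T a) := by
    have hρ4 : ρ ^ 2 ≤ 1 / 4 := by nlinarith
    have hN : IsProbabilityMeasure (gaussianSamples n (S a)) := by
      unfold gaussianSamples; infer_instance
    set ν := M ∘ₘ gaussianSamples n (S a) with hν
    have h1 := hE (S a) (wellConditioned_of_frobeniusSq_le (hS a).1 ((hS a).2.le.trans hρ4))
    have h2 := meas_ge_le_lintegral_div (μ := ν)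
      (measurable_frobeniusSq_sub (S a)).ennreal_ofReal.aemeasurable
      (ε := ENNReal.ofReal τ) (by simpa using hτpos) (by simp)
    have h3 : ν (T a)ᶜ ≤ ENNReal.ofReal (1 / 3) := by
      refine (measure_mono fun A hA => ?_).trans (h2.trans ((ENNReal.div_le_div_right h1 _).trans
        (le_of_eq ?_)))
      · exact ENNReal.ofReal_le_ofReal (not_lt.1 hA)
      · rw [← ENNReal.ofReal_div_of_pos hτpos]
        congr 1
        rw [hτ]
        field_simp
    have h4 : 1 - 1 / 3 ≤ ν.real (T a) := by
      have h5 := ENNReal.toReal_mono (by finiteness) h3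
      rw [ENNReal.toReal_ofReal (by norm_num)] at h5
      have h6 := probReal_add_probReal_compl (μ := ν) (hT a)
      change ν.real (T a)ᶜ ≤ _ at h5
      linarith
    rw [← ENNReal.toReal_le_toReal (by finiteness) (by finiteness), ENNReal.toReal_div]
    simp only [ENNReal.toReal_ofNat]
    change _ ≤ ν.real (T a)
    linarith
  have := hM.sample_size_ge hd hε hρpos hρ2 hS hC T (fun a _ => hT a) hdisj fun a _ => hsucc a
  refine le_trans (le_of_eq ?_) this
  rw [hρ]
  field_simp
  norm_num

end Mechanisms

open PrivateCovariance in
theorem mainTheorem9 :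
    (∃ α₀ : ℝ, 0 < α₀ ∧ α₀ ≤ 1 ∧ ∃ c : ℝ, 0 < c ∧
      ∀ (d n : ℕ) (ε α : ℝ), 0 < ε → 0 < α → α ≤ α₀ →
      ∀ M : Kernel (Fin n → EuclideanSpace ℝ (Fin d))
          (ProbabilityMeasure (EuclideanSpace ℝ (Fin d))),
        IsMarkovKernel M → IsDP M ε 0 → LearnsGaussian M α →
          c * ((d : ℝ) ^ 2 / (α * ε)) ≤ (n : ℝ)) ∧
    (∃ c : ℝ, 0 < c ∧
      ∀ (d n : ℕ) (ε α : ℝ), 0 < ε → 0 < α → α ≤ 1 →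
      ∀ M : Kernel (Fin n → EuclideanSpace ℝ (Fin d)) (PSDMatrix d),
        IsMarkovKernel M → IsDP M ε 0 → EstimatesCovariance M (α ^ 2 / 64) →
          c * ((d : ℝ) ^ 2 / (α * ε)) ≤ (n : ℝ)) := by
  refine ⟨⟨1 / 4000, by norm_num, by norm_num, 1 / 34560000, by norm_num, ?_⟩,
    1 / 8640, by norm_num, ?_⟩
  · intro d n ε α hε hα hα0 M _ hM hL
    -- For `d = 0` the bound reads `0 ≤ n`; the packing needs `d > 0`.
    rcases Nat.eq_zero_or_pos d with rfl | hd
    · simp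
    · exact hL.sample_size_ge hd hε hα hα0 hM
  · intro d n ε α hε hα hα1 M _ hM hE
    rcases Nat.eq_zero_or_pos d with rfl | hd
    · simp
    · exact hE.sample_size_ge hd hε hα hα1 hM
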